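/- Let $d\ge 1$. For $a,\omega\in\mathbb R^d$ let $T_af(x)=f(x-a)$ and $M_\omega f(x)=e^{2\pi i\langle \omega,x\rangle}f(x)$ on $L^2(\mathbb R^d)$, let $\hat f$ be the Fourier transform (the unitary extension of $\hat f(\omega)=\int_{\mathbb R^d} f(x)e^{-2\pi i\langle\omega,x\rangle}\,dx$), and put $\mathbf{\tfrac12}=(\tfrac12,\dots,\tfrac12)\in\mathbb R^d$ and $(-1)^{|n|}=(-1)^{n_1+\dots+n_d}$ for $n\in\mathbb Z^d$. Let $g\in L^2(\mathbb R^d)$ satisfy $\hat g(\omega)=\overline{\hat g(\omega)}$ for a.e. $\omega$, and let $N\subset\mathbb Z^d$ satisfy $N\cap(-N)=\emptyset$ and $N\cup(-N)\cup\{0\}=\mathbb Z^d$. Consider the Gabor system $$\mathcal G(g)=\{T_\lambda M_\gamma g\}_{\lambda\in\mathbb Z^d\cup(\mathbf{1/2}+\mathbb Z^d),\ \gamma\in\mathbb Z^d}$$ and the bimodular Wilson system $$\mathcal W(g)=\{T_\lambda g\}_{\lambda\in\mathbb Z^d}\ \cup\ \{\tfrac1{\sqrt2}T_\lambda(M_\gamma+(-1)^{|\gamma|}M_{-\gamma})g\}_{\lambda\in\mathbb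 Z^d,\gamma\in N}\ \cup\ \{\tfrac1{\sqrt2}T_{\lambda+\mathbf{1/2}}(M_\gamma-(-1)^{|\gamma|}M_{-\gamma})g\}_{\lambda\in\mathbb Z^d,\gamma\in N},$$ both regarded as families indexed as displayed. A family $(\varphi_i)_i$ in $L^2(\mathbb R^d)$ is a Bessel sequence with bound $b$ if $\sum_i|\langle f,\varphi_i\rangle|^2\le b\|f\|^2$ for all $f$; its frame operator is then $Sf=\sum_i\langle f,\varphi_i\rangle\varphi_i$ (unconditionally convergent). It is a frame with bounds $a$ and $b$ if $a>0$ and $a\|f\|^2\le\sum_i|\langle f,\varphi_i\rangle|^2\le b\|f\|^2$ for all $f$, and a tight frame with bound $a$ if moreover one can take $b=a$. It is a Riesz basis with bounds $a$ and $b$ if $a>0$, its linear span is dense in $L^2(\mathbb R^d)$, and $a\sum_i|c_i|^2\le\|\sum_i c_i\varphi_i\|^2\le b\sum_i|c_i|^2$ for all finitely supported scalar families $(c_i)_i$. Then the following hold. (i) For every $b\in\mathbb R$, $\mathcal G(g)$ is a Bessel sequence with bound $b$ if and only if $\mathcal W(g)$ is a Bessel sequence with bound $b/2$. If either system is a Bessel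 sequence (and hence both are), the frame operators satisfy $S_{\mathcal G}=2S_{\mathcal W}$. (ii) For all $a,b\in\mathbb R$, $\mathcal G(g)$ is a frame for $L^2(\mathbb R^d)$ with bounds $2a$ and $2b$ if and only if $\mathcal W(g)$ is a Riesz basis for $L^2(\mathbb R^d)$ with bounds $a$ and $b$. (iii) $\mathcal G(g)$ is a tight frame for $L^2(\mathbb R^d)$ with bound $2$ if and only if $\mathcal W(g)$ is an orthonormal basis for $L^2(\mathbb R^d)$. -/

import Mathlib

open MeasureTheory FourierTransform
open scoped Pointwise

noncomputable section

namespace WilsonSystem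

/-! ### Frames, Bessel sequences and Riesz bases in a Hilbert space -/

section Frames

variable {ι H : Type*} [NormedAddCommGroup H] [InnerProductSpace ℂ H]

/-- `φ` is a Bessel sequence with bound `b`: `∑ |⟨f, φ i⟩|² ≤ b ‖f‖²` for all `f`. -/
def IsBesselWith (φ : ι → H) (b : ℝ) : Prop :=
  ∀ f : H, Summable (fun i => ‖inner ℂ (φ i) f‖ ^ 2) ∧
    ∑' i, ‖inner ℂ (φ i) f‖ ^ 2 ≤ b * ‖f‖ ^ 2

/-- `φ` is a frame with bounds `a > 0` and `b`:
`a ‖f‖² ≤ ∑ |⟨f, φ i⟩|² ≤ b ‖f‖²` for all `f`. -/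
def IsFrameWith (φ : ι → H) (a b : ℝ) : Prop :=
  0 < a ∧ IsBesselWith φ b ∧ ∀ f : H, a * ‖f‖ ^ 2 ≤ ∑' i, ‖inner ℂ (φ i) f‖ ^ 2

/-- `φ` is a tight frame with frame bound `a`. -/
def IsTightFrameWith (φ : ι → H) (a : ℝ) : Prop :=
  IsFrameWith φ a a

/-- The frame operator `f ↦ ∑ ⟨f, φ i⟩ φ i`. Mathlib's inner product is linear in its second
argument. -/
def frameOperator (φ : ι → H) (f : H) : H :=
  ∑' i, inner ℂ (φ i) f • φ i

/-- `φ` is a Riesz basis with bounds `a > 0` and `b`: its span is dense, and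
`a ∑ |c i|² ≤ ‖∑ c i φ i‖² ≤ b ∑ |c i|²` for all finitely supported scalar families `c`. -/
def IsRieszBasisWith (φ : ι → H) (a b : ℝ) : Prop :=
  0 < a ∧ (Submodule.span ℂ (Set.range φ)).topologicalClosure = ⊤ ∧
    ∀ c : ι →₀ ℂ,
      a * (∑ i ∈ c.support, ‖c i‖ ^ 2) ≤ ‖∑ i ∈ c.support, c i • φ i‖ ^ 2 ∧
      ‖∑ i ∈ c.support, c i • φ i‖ ^ 2 ≤ b * (∑ i ∈ c.support, ‖c i‖ ^ 2)

/-- `φ` is an orthonormal basis of the Hilbert space `H`. -/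
def IsOrthonormalBasis (φ : ι → H) : Prop :=
  ∃ B : HilbertBasis ι ℂ H, ⇑B = φ

end Frames

/-! ### Time-frequency shifts on `L²(ℝᵈ)` -/

/-- The Hilbert space `L²(ℝᵈ)` of complex-valued functions. -/
abbrev L2 (d : ℕ) : Type :=
  Lp (α := EuclideanSpace ℝ (Fin d)) ℂ 2 volume

/-- The integer vector `n`, as a point of `ℝᵈ`. -/
def intVec {d : ℕ} (n : Fin d → ℤ) : EuclideanSpace ℝ (Fin d) :=
  WithLp.toLp 2 fun i => (n i : ℝ)

/-- The constant vector `(1/2, …, 1/2)`. -/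
def halfVec (d : ℕ) : EuclideanSpace ℝ (Fin d) :=
  WithLp.toLp 2 fun _ => 1 / 2

/-- The translation operator `T_a f (x) = f (x - a)`. -/
def translate {d : ℕ} (a : EuclideanSpace ℝ (Fin d)) (f : L2 d) : L2 d :=
  Lp.compMeasurePreserving (fun x => x - a) (measurePreserving_sub_right volume a) f

theorem memLp_modulate {d : ℕ} (ω : EuclideanSpace ℝ (Fin d)) (f : L2 d) :
    MemLp (fun x => Complex.exp (2 * Real.pi * Complex.I * (inner ℝ ω x : ℝ)) * f x) 2
      (volume : Measure (EuclideanSpace ℝ (Fin d))) := by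
  refine (Lp.memLp f).of_le ?_ (Filter.Eventually.of_forall fun x => ?_)
  · refine AEStronglyMeasurable.mul ?_ (Lp.aestronglyMeasurable f)
    exact Continuous.aestronglyMeasurable (by fun_prop)
  · have h : (2 * Real.pi * Complex.I * (inner ℝ ω x : ℝ) : ℂ)
        = ((2 * Real.pi * inner ℝ ω x : ℝ) : ℂ) * Complex.I := by
      push_cast; ring
    rw [norm_mul, h, Complex.norm_exp_ofReal_mul_I, one_mul]

/-- The modulation operator `M_ω f (x) = exp(2πi⟨ω, x⟩) f (x)`. -/
def modulate {d : ℕ} (ω : EuclideanSpace ℝ (Fin d)) (f : L2 d) : L2 d :=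
  (memLp_modulate ω f).toLp _

/-- The sign `(-1)^{|n|} = (-1)^{n₁ + ⋯ + n_d}`. -/
def sign {d : ℕ} (n : Fin d → ℤ) : ℂ :=
  (-1) ^ (∑ i, n i)

/-! ### The Gabor system and the Wilson system -/

/-- The set of shifts `ℤᵈ ∪ (1/2 + ℤᵈ)` in `ℝᵈ`. -/
def shiftSet (d : ℕ) : Set (EuclideanSpace ℝ (Fin d)) :=
  Set.range intVec ∪ Set.range (fun n => halfVec d + intVec n)

/-- The Gabor system `{T_λ M_γ g}` with `λ ∈ ℤᵈ ∪ (1/2 + ℤᵈ)` and `γ ∈ ℤᵈ`. -/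
def gabor {d : ℕ} (g : L2 d) : shiftSet d × (Fin d → ℤ) → L2 d :=
  fun p => translate p.1 (modulate (intVec p.2) g)

/-- The index set of the Wilson system: one copy of `ℤᵈ` and two copies of `ℤᵈ × N`. -/
abbrev WilsonIndex {d : ℕ} (N : Set (Fin d → ℤ)) : Type :=
  (Fin d → ℤ) ⊕ ((Fin d → ℤ) × N) ⊕ ((Fin d → ℤ) × N)

/-- The bimodular Wilson system, consisting of `T_λ g`,
`2^{-1/2} T_λ (M_γ + (-1)^{|γ|} M_{-γ}) g` and
`2^{-1/2} T_{λ + 1/2} (M_γ - (-1)^{|γ|} M_{-γ}) g`, with `λ ∈ ℤᵈ` and `γ ∈ N`. -/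
def wilson {d : ℕ} (N : Set (Fin d → ℤ)) (g : L2 d) : WilsonIndex N → L2 d
  | Sum.inl l => translate (intVec l) g
  | Sum.inr (Sum.inl (l, γ)) =>
      ((1 / Real.sqrt 2 : ℝ) : ℂ) • translate (intVec l)
        (modulate (intVec (γ : Fin d → ℤ)) g
          + sign (γ : Fin d → ℤ) • modulate (intVec (-(γ : Fin d → ℤ))) g)
  | Sum.inr (Sum.inr (l, γ)) =>
      ((1 / Real.sqrt 2 : ℝ) : ℂ) • translate (intVec l + halfVec d)
        (modulate (intVec (γ : Fin d → ℤ)) g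
          - sign (γ : Fin d → ℤ) • modulate (intVec (-(γ : Fin d → ℤ))) g)

end WilsonSystem

end

/-!
On the Fourier side the Gabor system consists of the functions `e^{-2πi⟨λ,ω⟩} G(ω - γ)`, where
`G = 𝓕 g` is real. All sums over shifts are evaluated by Parseval's identity for Fourier series on
the unit cube, tested against the wave packets `atom k n`, whose Fourier transforms are plane waves
of integer frequency cut off to integer cubes. The wave packets span a dense subspace
(`dense_span_atom`), and their coefficients are square summable for every `g`.

Comparison of the quadratic forms. Expanding the Wilson elements shows that twice the quadratic form
of the Wilson system differs from that of the Gabor system only by cross terms between `M_γ g` and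
`M_{-γ} g`. For two wave packets living on the cubes with corners `k` and `k'`, the sum over the
shifts in `ℤᵈ` of these terms is `(-1)^{|γ|}` times a symmetric function (as `G` is real) of
`k - γ` and `k' + γ`, and the sum over the shifts in `1/2 + ℤᵈ` is the same with the factor
`(-1)^{|k| + |k'|}`. The difference vanishes if `|k| + |k'|` is even; if it is odd, the substitution
`γ ↦ k - k' - γ` changes the sign of the sum over `γ` (`hasSum_crossTerm_atom`). Hence the quadratic
forms agree up to the factor two on a dense subspace, and by continuity and polarization the Bessel
bounds, the frame bounds and the frame operators correspond.

From frames to Riesz bases. Let the Wilson system be a frame with frame operator `S`. As `2 S` is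
the frame operator of the Gabor system, `S` commutes with the time-frequency shifts, so the dual
frame is the Wilson system of the window `h` with `S h = g`. Testing the reconstruction formula of
the Gabor system against two wave packets gives the Wexler–Raz relation `⟪h, M_m g⟫ = δ_{m,0}` for
`|m|` even (`inner_modulate_dual`). Only `m = 0` and `m = ±2γ` enter the diagonal inner products of
the Wilson system with its dual, which are therefore equal to one, and a frame with this property is
biorthogonal to its dual, hence a Riesz basis with the same bounds. The converse holds in every
Hilbert space, and orthonormal bases are the Riesz bases with both bounds equal to one.
-/

namespace WilsonSystem

/-! ### Bessel sequences, frames and Riesz bases in an abstract Hilbert space -/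

section Hilbert

variable {ι κ H : Type*} [NormedAddCommGroup H] [InnerProductSpace ℂ H]

theorem isBesselWith_iff_sum_le {φ : ι → H} {b : ℝ} :
    IsBesselWith φ b ↔ ∀ (f : H) (s : Finset ι), ∑ i ∈ s, ‖inner ℂ (φ i) f‖ ^ 2 ≤ b * ‖f‖ ^ 2 := by
  constructor
  · intro h f s
    exact ((h f).1.sum_le_tsum s fun i _ => by positivity).trans (h f).2
  · intro h f
    have hs := summable_of_sum_le (f := fun i => ‖inner ℂ (φ i) f‖ ^ 2)
      (fun i => by positivity) (h f)
    exact ⟨hs, hs.tsum_le_of_sum_le (h f)⟩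

theorem IsBesselWith.mono {φ : ι → H} {b b' : ℝ} (h : IsBesselWith φ b) (hb : b ≤ b') :
    IsBesselWith φ b' := fun f =>
  ⟨(h f).1, (h f).2.trans (by gcongr)⟩

/-- The Bessel property only has to be checked on a dense set, because finite partial sums are
continuous. -/
theorem isBesselWith_of_dense {φ : ι → H} {b : ℝ} {D : Set H} (hD : Dense D)
    (h : ∀ f ∈ D, Summable (fun i => ‖inner ℂ (φ i) f‖ ^ 2) ∧
      ∑' i, ‖inner ℂ (φ i) f‖ ^ 2 ≤ b * ‖f‖ ^ 2) : IsBesselWith φ b := by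
  rw [isBesselWith_iff_sum_le]
  intro f s
  have hc : IsClosed {f : H | ∑ i ∈ s, ‖inner ℂ (φ i) f‖ ^ 2 ≤ b * ‖f‖ ^ 2} :=
    isClosed_le (by fun_prop) (by fun_prop)
  have hsub : D ⊆ {f : H | ∑ i ∈ s, ‖inner ℂ (φ i) f‖ ^ 2 ≤ b * ‖f‖ ^ 2} := fun f hf =>
    ((h f hf).1.sum_le_tsum s fun i _ => by positivity).trans (h f hf).2
  exact hc.closure_subset_iff.2 hsub (hD f)

theorem norm_sum_smul_sq_le (φ : ι → H) (s : Finset ι) (c : ι → ℂ) :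
    ‖∑ i ∈ s, c i • φ i‖ ^ 2 ≤ ∑ i ∈ s, ‖c i‖ * ‖inner ℂ (φ i) (∑ j ∈ s, c j • φ j)‖ := by
  set u := ∑ i ∈ s, c i • φ i with hu
  have h1 : (inner ℂ u u : ℂ) = ∑ i ∈ s, c i * inner ℂ u (φ i) := by
    nth_rewrite 2 [hu]
    rw [inner_sum]
    exact Finset.sum_congr rfl fun i _ => inner_smul_right _ _ _
  have h2 : ‖(inner ℂ u u : ℂ)‖ = ‖u‖ ^ 2 := by
    rw [inner_self_eq_norm_sq_to_K]; simp
  rw [← h2, h1]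
  refine (norm_sum_le _ _).trans (Finset.sum_le_sum fun i _ => ?_)
  rw [norm_mul, norm_inner_symm]

/-- The synthesis operator of a Bessel sequence is bounded. -/
theorem IsBesselWith.norm_sum_sq_le {φ : ι → H} {b : ℝ} (h : IsBesselWith φ b) (hb : 0 ≤ b)
    (s : Finset ι) (c : ι → ℂ) :
    ‖∑ i ∈ s, c i • φ i‖ ^ 2 ≤ b * ∑ i ∈ s, ‖c i‖ ^ 2 := by
  set u := ∑ i ∈ s, c i • φ i with hu
  have h1 : ‖u‖ ^ 2 ≤ ∑ i ∈ s, ‖c i‖ * ‖inner ℂ (φ i) u‖ := norm_sum_smul_sq_le φ s c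
  have h2 := Finset.sum_mul_sq_le_sq_mul_sq s (fun i => ‖c i‖) (fun i => ‖inner ℂ (φ i) u‖)
  have h3 := isBesselWith_iff_sum_le.1 h u s
  have hC : 0 ≤ ∑ i ∈ s, ‖c i‖ ^ 2 := by positivity
  have h4 : (‖u‖ ^ 2) ^ 2 ≤ (∑ i ∈ s, ‖c i‖ ^ 2) * (b * ‖u‖ ^ 2) :=
    (pow_le_pow_left₀ (by positivity) h1 2).trans (h2.trans (by gcongr))
  rcases (sq_nonneg ‖u‖).eq_or_lt with h0 | h0
  · rw [← h0]; positivity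
  · nlinarith

/-- The frame operator of a Bessel sequence converges unconditionally and is bounded. -/
theorem IsBesselWith.exists_frameOperator [CompleteSpace H] {φ : ι → H} {b : ℝ}
    (h : IsBesselWith φ b) (hb : 0 ≤ b) :
    ∃ S : H →L[ℂ] H, ∀ f, HasSum (fun i => inner ℂ (φ i) f • φ i) (S f) := by
  have hs : ∀ f, Summable (fun i => inner ℂ (φ i) f • φ i) := by
    intro f
    rw [summable_iff_vanishing_norm]
    intro ε hε
    obtain ⟨s, hs⟩ := summable_iff_vanishing_norm.1 (h f).1 (ε ^ 2 / (b + 1)) (by positivity)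
    refine ⟨s, fun t ht => ?_⟩
    have h1 := h.norm_sum_sq_le hb t (fun i => inner ℂ (φ i) f)
    have h2 := (le_abs_self _).trans_lt (hs t ht)
    rw [lt_div_iff₀ (by positivity)] at h2
    have h3 : 0 ≤ ∑ i ∈ t, ‖inner ℂ (φ i) f‖ ^ 2 := by positivity
    refine lt_of_pow_lt_pow_left₀ 2 hε.le ?_
    nlinarith
  let T : H →ₗ[ℂ] H :=
    { toFun := frameOperator φ
      map_add' := fun x y => by
        simp only [frameOperator, inner_add_right, add_smul]
        exact (hs x).tsum_add (hs y)
      map_smul' := fun c x => by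
        simp only [frameOperator, inner_smul_right, mul_smul, RingHom.id_apply]
        exact (hs x).tsum_const_smul c }
  refine ⟨T.mkContinuous b fun f => ?_, fun f => (hs f).hasSum⟩
  refine le_of_tendsto (hs f).hasSum.norm (Filter.Eventually.of_forall fun s => ?_)
  have h1 := h.norm_sum_sq_le hb s (fun i => inner ℂ (φ i) f)
  have h2 := isBesselWith_iff_sum_le.1 h f s
  refine le_of_sq_le_sq ?_ (by positivity)
  nlinarith [mul_le_mul_of_nonneg_left h2 hb]

theorem hasSum_inner_mul_inner {φ : ι → H} {f Sf : H}
    (hS : HasSum (fun i => inner ℂ (φ i) f • φ i) Sf) (y : H) :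
    HasSum (fun i => inner ℂ (φ i) f * inner ℂ y (φ i)) (inner ℂ y Sf) := by
  simpa [inner_smul_right] using (innerSL ℂ y).hasSum hS

theorem hasSum_ofReal_norm_inner_sq {φ : ι → H} {f Sf : H}
    (hS : HasSum (fun i => inner ℂ (φ i) f • φ i) Sf) :
    HasSum (fun i => ((‖inner ℂ (φ i) f‖ ^ 2 : ℝ) : ℂ)) (inner ℂ f Sf) := by
  convert hasSum_inner_mul_inner hS f using 2 with i
  rw [← inner_conj_symm f (φ i), RCLike.mul_conj]
  simp

theorem hasSum_norm_inner_sq {φ : ι → H} {f Sf : H}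
    (hS : HasSum (fun i => inner ℂ (φ i) f • φ i) Sf) :
    HasSum (fun i => ‖inner ℂ (φ i) f‖ ^ 2) (inner ℂ f Sf).re ∧
      inner ℂ f Sf = ((∑' i, ‖inner ℂ (φ i) f‖ ^ 2 : ℝ) : ℂ) := by
  have h := hasSum_ofReal_norm_inner_sq hS
  have h1 : HasSum (fun i => ‖inner ℂ (φ i) f‖ ^ 2) (inner ℂ f Sf).re := by
    simpa only [Complex.ofReal_re] using Complex.hasSum_re h
  refine ⟨h1, ?_⟩
  rw [h1.tsum_eq]
  exact h.unique (Complex.hasSum_ofReal.2 h1)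

section Transfer

variable {φ : ι → H} {ψ : κ → H} {D : Set H}

theorem isBesselWith_iff_of_dense (hD : Dense D)
    (h : ∀ f ∈ D, Summable (fun i => ‖inner ℂ (φ i) f‖ ^ 2) ∧
      Summable (fun j => ‖inner ℂ (ψ j) f‖ ^ 2) ∧
      ∑' i, ‖inner ℂ (φ i) f‖ ^ 2 = 2 * ∑' j, ‖inner ℂ (ψ j) f‖ ^ 2) (b : ℝ) :
    IsBesselWith φ b ↔ IsBesselWith ψ (b / 2) := by
  constructor
  · intro hφ
    refine isBesselWith_of_dense hD fun f hf => ⟨(h f hf).2.1, ?_⟩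
    have := (hφ f).2
    rw [(h f hf).2.2] at this
    linarith
  · intro hψ
    refine isBesselWith_of_dense hD fun f hf => ⟨(h f hf).1, ?_⟩
    have := (hψ f).2
    rw [(h f hf).2.2]
    linarith

/-- If two Bessel sequences have proportional quadratic forms on a dense set, their frame
operators are proportional, by continuity and polarization. -/
theorem frameOperator_eq_two_smul (hD : Dense D)
    (h : ∀ f ∈ D, ∑' i, ‖inner ℂ (φ i) f‖ ^ 2 = 2 * ∑' j, ‖inner ℂ (ψ j) f‖ ^ 2)
    {S S' : H →L[ℂ] H}
    (hS : ∀ f, HasSum (fun i => inner ℂ (φ i) f • φ i) (S f))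
    (hS' : ∀ f, HasSum (fun j => inner ℂ (ψ j) f • ψ j) (S' f)) (f : H) :
    S f = (2 : ℂ) • S' f := by
  have hq : (fun f => inner ℂ f (S f)) = fun f => inner ℂ f ((2 : ℂ) • S' f) := by
    refine Continuous.ext_on hD (by fun_prop) (by fun_prop) fun f hf => ?_
    simp only [inner_smul_right]
    rw [(hasSum_norm_inner_sq (hS f)).2, (hasSum_norm_inner_sq (hS' f)).2, h f hf]
    push_cast
    rfl
  have : (S : H →ₗ[ℂ] H) = (((2 : ℂ) • S' : H →L[ℂ] H) : H →ₗ[ℂ] H) := by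
    rw [← ext_inner_map]
    intro x
    have := congr_arg (starRingEnd ℂ) (congr_fun hq x)
    rwa [inner_conj_symm, inner_conj_symm] at this
  exact LinearMap.congr_fun this f

end Transfer

/-- A Riesz basis is a frame with the same bounds. -/
theorem IsRieszBasisWith.isFrameWith [CompleteSpace H] [Nonempty ι] {φ : ι → H} {a b : ℝ}
    (h : IsRieszBasisWith φ a b) : IsFrameWith φ a b := by
  obtain ⟨ha, hd, hc⟩ := h
  -- The Riesz inequalities hold for coefficients on a finite set even if some of them vanish.
  have hc' : ∀ (s : Finset ι) (c : ι → ℂ), a * (∑ i ∈ s, ‖c i‖ ^ 2) ≤ ‖∑ i ∈ s, c i • φ i‖ ^ 2 ∧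
      ‖∑ i ∈ s, c i • φ i‖ ^ 2 ≤ b * (∑ i ∈ s, ‖c i‖ ^ 2) := by
    classical
    intro s c
    have := hc (Finsupp.onFinset s (fun i => if i ∈ s then c i else 0) (by grind))
    have hsub : (Finsupp.onFinset s (fun i => if i ∈ s then c i else 0) (by grind)).support ⊆ s :=
      Finsupp.support_onFinset_subset
    rw [Finset.sum_subset hsub (by intro i _ hi; simp at hi ⊢; grind),
      Finset.sum_subset hsub (by intro i _ hi; simp at hi ⊢; grind)] at this
    have e1 : ∑ i ∈ s, (if i ∈ s then c i else 0) • φ i = ∑ i ∈ s, c i • φ i :=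
      Finset.sum_congr rfl fun i hi => by rw [if_pos hi]
    have e2 : ∑ i ∈ s, ‖if i ∈ s then c i else 0‖ ^ 2 = ∑ i ∈ s, ‖c i‖ ^ 2 :=
      Finset.sum_congr rfl fun i hi => by rw [if_pos hi]
    rw [← e1, ← e2]
    exact this
  have hb : 0 ≤ b := by
    obtain ⟨i⟩ := ‹Nonempty ι›
    have := hc' {i} (fun _ => 1)
    simp at this
    linarith
  -- The upper bound: apply the Riesz inequality to the coefficients `⟪φ i, f⟫` themselves.
  have hB : IsBesselWith φ b := by
    rw [isBesselWith_iff_sum_le]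
    intro f s
    set q := ∑ i ∈ s, ‖inner ℂ (φ i) f‖ ^ 2 with hq
    have hq0 : 0 ≤ q := by positivity
    have h1 := (hc' s (fun i => inner ℂ (φ i) f)).2
    set u := ∑ i ∈ s, (inner ℂ (φ i) f : ℂ) • φ i with hu
    have h2 : (inner ℂ u f : ℂ) = (q : ℂ) := by
      rw [hu, sum_inner, hq]
      push_cast
      refine Finset.sum_congr rfl fun i _ => ?_
      rw [inner_smul_left, mul_comm, RCLike.mul_conj]; simp
    have h3 : q ≤ ‖u‖ * ‖f‖ := by
      have := norm_inner_le_norm (𝕜 := ℂ) u f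
      rwa [h2, Complex.norm_real, Real.norm_of_nonneg hq0] at this
    have h4 : q ^ 2 ≤ b * q * ‖f‖ ^ 2 := by
      calc q ^ 2 ≤ (‖u‖ * ‖f‖) ^ 2 := by gcongr
        _ = ‖u‖ ^ 2 * ‖f‖ ^ 2 := by ring
        _ ≤ _ := by gcongr
    rcases hq0.eq_or_lt with h0 | h0
    · rw [← h0]; positivity
    · nlinarith
  refine ⟨ha, hB, ?_⟩
  -- The lower bound is proved on the span of `φ` and extended by continuity of the quadratic form.
  obtain ⟨S, hS⟩ := hB.exists_frameOperator hb
  have hcl : IsClosed {f : H | a * ‖f‖ ^ 2 ≤ (inner ℂ f (S f)).re} :=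
    isClosed_le (by fun_prop) (Complex.continuous_re.comp (by fun_prop))
  intro f
  have hsub : (Submodule.span ℂ (Set.range φ) : Set H) ⊆
      {f : H | a * ‖f‖ ^ 2 ≤ (inner ℂ f (S f)).re} := by
    intro f hf
    obtain ⟨c, rfl⟩ := (Finsupp.mem_span_range_iff_exists_finsupp).1 hf
    set f := c.sum fun i x => x • φ i with hf
    simp only [Set.mem_ofPred_eq]
    have hq := hasSum_norm_inner_sq (hS f)
    rw [← hq.1.tsum_eq]
    set q := ∑' i, ‖inner ℂ (φ i) f‖ ^ 2 with hqq
    have h1 := (hc c).1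
    have hfs : f = ∑ i ∈ c.support, c i • φ i := rfl
    rw [← hfs] at h1
    have h2 : ‖f‖ ^ 2 ≤ ∑ i ∈ c.support, ‖c i‖ * ‖inner ℂ (φ i) f‖ :=
      norm_sum_smul_sq_le φ c.support c
    have h3 := Finset.sum_mul_sq_le_sq_mul_sq c.support (fun i => ‖c i‖)
      (fun i => ‖inner ℂ (φ i) f‖)
    have h5 : ∑ i ∈ c.support, ‖inner ℂ (φ i) f‖ ^ 2 ≤ q :=
      hq.1.summable.sum_le_tsum _ fun i _ => by positivity
    have hC : 0 ≤ ∑ i ∈ c.support, ‖c i‖ ^ 2 := by positivity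
    have hq0 : 0 ≤ q := tsum_nonneg fun i => by positivity
    have h4 : (‖f‖ ^ 2) ^ 2 ≤ (∑ i ∈ c.support, ‖c i‖ ^ 2) * q :=
      (pow_le_pow_left₀ (by positivity) h2 2).trans (h3.trans (by gcongr))
    have h6 : a * (‖f‖ ^ 2) ^ 2 ≤ ‖f‖ ^ 2 * q := by nlinarith
    rcases (sq_nonneg ‖f‖).eq_or_lt with h0 | h0
    · rw [← h0]; simpa using hq0
    · nlinarith
  have hcl' := hcl.closure_subset_iff.2 hsub
  have hf : f ∈ closure (Submodule.span ℂ (Set.range φ) : Set H) := by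
    rw [← Submodule.topologicalClosure_coe, hd]; trivial
  have := hcl' hf
  rwa [Set.mem_ofPred_eq, ← (hasSum_norm_inner_sq (hS f)).1.tsum_eq] at this

/-- If `S` is the frame operator of `φ` and `S (ψ i) = φ i` with `⟪ψ i, φ i⟫ = 1`, then `ψ` and `φ`
are biorthogonal: expanding `⟪ψ i, S (ψ i)⟫ = ∑ |⟪φ j, ψ i⟫|²`, the term `j = i` already
accounts for the whole sum. -/
theorem inner_eq_zero_of_inner_dual_eq_one {φ ψ : ι → H} {S : H → H}
    (hS : ∀ f, HasSum (fun i => inner ℂ (φ i) f • φ i) (S f))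
    (hψ : ∀ i, S (ψ i) = φ i) (h1 : ∀ i, inner ℂ (ψ i) (φ i) = 1) {i j : ι} (hij : j ≠ i) :
    inner ℂ (φ j) (ψ i) = 0 := by
  classical
  have h := (hasSum_norm_inner_sq (hS (ψ i))).1
  rw [hψ, h1] at h
  have h2 := sum_le_hasSum {i, j} (fun k _ => by positivity) h
  have h3 : ‖inner ℂ (φ i) (ψ i)‖ = 1 := by rw [norm_inner_symm, h1, norm_one]
  rw [Finset.sum_pair hij.symm, h3] at h2
  simp only [Complex.one_re] at h2
  have : ‖inner ℂ (φ j) (ψ i)‖ ^ 2 = 0 := le_antisymm (by linarith) (by positivity)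
  simpa using this

/-- A frame whose dual frame has diagonal inner products equal to one is a Riesz basis, with the
same bounds. -/
theorem IsFrameWith.isRieszBasisWith [CompleteSpace H] {φ ψ : ι → H} {a b : ℝ}
    (h : IsFrameWith φ a b) {S : H →L[ℂ] H}
    (hS : ∀ f, HasSum (fun i => inner ℂ (φ i) f • φ i) (S f))
    (hψ : ∀ i, S (ψ i) = φ i) (h1 : ∀ i, inner ℂ (ψ i) (φ i) = 1) :
    IsRieszBasisWith φ a b := by
  classical
  obtain ⟨ha, hB, hl⟩ := h
  refine ⟨ha, ?_, fun c => ⟨?_, ?_⟩⟩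
  · rw [Submodule.topologicalClosure_eq_top_iff, Submodule.eq_bot_iff]
    intro x hx
    have h0 : ∀ i, (inner ℂ (φ i) x : ℂ) = 0 := fun i =>
      Submodule.inner_right_of_mem_orthogonal (Submodule.subset_span (Set.mem_range_self i)) hx
    have := hl x
    simp only [h0, norm_zero, ne_eq, OfNat.ofNat_ne_zero, not_false_eq_true, zero_pow,
      tsum_zero] at this
    have h2 : ‖x‖ ^ 2 = 0 := le_antisymm (nonpos_of_mul_nonpos_right this ha) (by positivity)
    simpa using h2
  · set u := ∑ i ∈ c.support, c i • φ i with hu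
    -- By biorthogonality `c` consists of the frame coefficients of `v`, and `S v = u`.
    set v := ∑ i ∈ c.support, c i • ψ i with hv
    have hSv : S v = u := by simp [hv, hu, hψ]
    have hq := hasSum_norm_inner_sq (hS v)
    have hlv := hl v
    rw [hq.1.tsum_eq] at hlv
    set q := (inner ℂ v (S v)).re with hqq
    have hcoef : ∀ j ∈ c.support, inner ℂ (φ j) v = c j := by
      intro j hj
      rw [hv, inner_sum, Finset.sum_eq_single j]
      · rw [inner_smul_right, ← inner_conj_symm, h1]; simp
      · intro i _ hij
        rw [inner_smul_right, inner_eq_zero_of_inner_dual_eq_one hS hψ h1 hij.symm, mul_zero]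
      · exact fun h => absurd hj h
    have hle : ∑ i ∈ c.support, ‖c i‖ ^ 2 ≤ q := by
      refine le_trans (le_of_eq ?_) (sum_le_hasSum c.support (fun k _ => by positivity) hq.1)
      exact Finset.sum_congr rfl fun i hi => by rw [hcoef i hi]
    have hq0 : 0 ≤ q := hq.1.nonneg fun i => by positivity
    have hqu : q ≤ ‖v‖ * ‖u‖ := by
      rw [← hSv]
      exact (Complex.re_le_norm _).trans (norm_inner_le_norm _ _)
    have h6 : a * q ^ 2 ≤ q * ‖u‖ ^ 2 := by
      calc a * q ^ 2 ≤ a * (‖v‖ * ‖u‖) ^ 2 := by gcongr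
        _ = (a * ‖v‖ ^ 2) * ‖u‖ ^ 2 := by ring
        _ ≤ _ := by gcongr
    refine (mul_le_mul_of_nonneg_left hle ha.le).trans ?_
    rcases hq0.eq_or_lt with h0 | h0
    · rw [← h0]; simp
    · nlinarith
  · rcases Finset.eq_empty_or_nonempty c.support with h0 | ⟨i, _⟩
    · simp [h0]
    · refine hB.norm_sum_sq_le ?_ _ _
      -- The space contains a nonzero vector, so the upper frame bound is nonnegative.
      have hne : φ i ≠ 0 := by
        intro h0
        have := h1 i
        simp [h0] at this
      have h2 := (hl (φ i)).trans (hB (φ i)).2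
      have h3 : 0 < ‖φ i‖ ^ 2 := by positivity
      nlinarith

/-- The Riesz bases with both bounds equal to one are the orthonormal bases. -/
theorem isRieszBasisWith_one_one_iff [CompleteSpace H] {φ : ι → H} [Nonempty ι] :
    IsRieszBasisWith φ 1 1 ↔ IsOrthonormalBasis φ := by
  classical
  constructor
  · intro h
    have hF := h.isFrameWith
    obtain ⟨S, hS⟩ := hF.2.1.exists_frameOperator zero_le_one
    have hn : ∀ i, ‖φ i‖ = 1 := fun i => by
      have := h.2.2 (Finsupp.single i 1)
      rw [Finsupp.support_single _ one_ne_zero] at this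
      simp at this
      have h2 : ‖φ i‖ ^ 2 = 1 := le_antisymm (by simpa using this.2) (by simpa using this.1)
      exact (pow_eq_one_iff_of_nonneg (norm_nonneg _) two_ne_zero).1 h2
    have hT : ∀ f, ∑' i, ‖inner ℂ (φ i) f‖ ^ 2 = ‖f‖ ^ 2 := fun f =>
      le_antisymm (by simpa using (hF.2.1 f).2) (by simpa using hF.2.2 f)
    -- In a Parseval frame of unit vectors, `‖φ j‖² = 1` is already the `j`-th term of its sum.
    have hon : Orthonormal ℂ φ := by
      refine ⟨hn, fun i j hij => ?_⟩
      have h2 := (hF.2.1 (φ j)).1.sum_le_tsum {j, i} (fun k _ => by positivity)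
      rw [Finset.sum_pair hij.symm, hT, inner_self_eq_norm_sq_to_K, hn] at h2
      have h3 : ‖inner ℂ (φ i) (φ j)‖ ^ 2 = 0 :=
        le_antisymm (by simpa using h2) (by positivity)
      simpa using h3
    exact ⟨HilbertBasis.mk hon h.2.1.ge, HilbertBasis.coe_mk _ _⟩
  · rintro ⟨B, rfl⟩
    refine ⟨one_pos, B.dense_span, fun c => ?_⟩
    have : ‖∑ i ∈ c.support, c i • B i‖ ^ 2 = ∑ i ∈ c.support, ‖c i‖ ^ 2 := by
      have h2 := B.orthonormal.inner_sum c c c.support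
      rw [inner_self_eq_norm_sq_to_K] at h2
      have h3 : ((‖∑ i ∈ c.support, c i • B i‖ ^ 2 : ℝ) : ℂ) =
          ((∑ i ∈ c.support, ‖c i‖ ^ 2 : ℝ) : ℂ) := by
        push_cast
        rw [← RCLike.ofReal_eq_complex_ofReal, h2]
        refine Finset.sum_congr rfl fun i _ => ?_
        rw [mul_comm, RCLike.mul_conj]
      exact_mod_cast h3
    rw [this, one_mul]
    exact ⟨le_rfl, le_rfl⟩

/-- A linear isometry that permutes a system up to phases commutes with its frame operator. -/
theorem frameOperator_comm {φ : ι → H} {S : H → H}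
    (hS : ∀ f, HasSum (fun i => inner ℂ (φ i) f • φ i) (S f)) (U : H →ₗᵢ[ℂ] H) (σ : ι ≃ ι)
    (z : ι → ℂ) (hz : ∀ i, ‖z i‖ = 1) (hU : ∀ i, U (φ i) = z i • φ (σ i)) (f : H) :
    S (U f) = U (S f) := by
  have h1 : HasSum (fun i => U ((inner ℂ (φ i) f : ℂ) • φ i)) (U (S f)) :=
    U.toContinuousLinearMap.hasSum (hS f)
  have h2 := σ.hasSum_iff.2 (hS (U f))
  refine h2.unique ?_
  convert h1 using 1
  funext i
  have h3 : (inner ℂ (φ i) f : ℂ) = starRingEnd ℂ (z i) * inner ℂ (φ (σ i)) (U f) := by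
    rw [← U.inner_map_map, hU, inner_smul_left]
  rw [Function.comp_apply, map_smul, h3, hU, smul_smul, mul_right_comm, RCLike.conj_mul, hz]
  simp

end Hilbert

/-! ### Translations, modulations and the Fourier transform on `L²(ℝᵈ)` -/

section TimeFrequency

variable {d : ℕ}

/-- The plane wave `x ↦ exp(2πi⟨a, x⟩)` of frequency `a`. -/
noncomputable def planeWave (a x : EuclideanSpace ℝ (Fin d)) : ℂ :=
  Complex.exp (2 * Real.pi * Complex.I * (inner ℝ a x : ℝ))

theorem continuous_planeWave (a : EuclideanSpace ℝ (Fin d)) : Continuous (planeWave a) := by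
  unfold planeWave
  fun_prop

theorem planeWave_add_left (a b x : EuclideanSpace ℝ (Fin d)) :
    planeWave (a + b) x = planeWave a x * planeWave b x := by
  rw [planeWave, planeWave, planeWave, ← Complex.exp_add, inner_add_left]
  push_cast
  ring_nf

theorem planeWave_add_right (a x y : EuclideanSpace ℝ (Fin d)) :
    planeWave a (x + y) = planeWave a x * planeWave a y := by
  rw [planeWave, planeWave, planeWave, ← Complex.exp_add, inner_add_right]
  push_cast
  ring_nf

@[simp]
theorem planeWave_zero_left (x : EuclideanSpace ℝ (Fin d)) : planeWave 0 x = 1 := by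
  simp [planeWave]

@[simp]
theorem norm_planeWave (a x : EuclideanSpace ℝ (Fin d)) : ‖planeWave a x‖ = 1 := by
  have h : (2 * Real.pi * Complex.I * (inner ℝ a x : ℝ) : ℂ)
      = ((2 * Real.pi * inner ℝ a x : ℝ) : ℂ) * Complex.I := by
    push_cast; ring
  rw [planeWave, h, Complex.norm_exp_ofReal_mul_I]

theorem conj_planeWave (a x : EuclideanSpace ℝ (Fin d)) :
    starRingEnd ℂ (planeWave a x) = planeWave (-a) x := by
  rw [planeWave, planeWave, ← Complex.exp_conj]
  simp [inner_neg_left, map_ofNat]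

theorem planeWave_neg_right (a x : EuclideanSpace ℝ (Fin d)) :
    planeWave a (-x) = planeWave (-a) x := by
  simp [planeWave, inner_neg_left, inner_neg_right]

theorem intVec_add (m n : Fin d → ℤ) : intVec (m + n) = intVec m + intVec n := by
  ext i; simp [intVec]

theorem intVec_neg (n : Fin d → ℤ) : intVec (-n) = -intVec n := by
  ext i; simp [intVec]

theorem intVec_sub (m n : Fin d → ℤ) : intVec (m - n) = intVec m - intVec n := by
  ext i; simp [intVec]

@[simp]
theorem intVec_zero : intVec (0 : Fin d → ℤ) = 0 := by
  ext i; simp [intVec]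

@[simp]
theorem planeWave_intVec_intVec (m n : Fin d → ℤ) : planeWave (intVec m) (intVec n) = 1 := by
  have : (inner ℝ (intVec m) (intVec n) : ℝ) = ((∑ i, n i * m i : ℤ) : ℝ) := by
    simp [intVec, PiLp.inner_apply]
  rw [planeWave, this, Complex.exp_eq_one_iff]
  exact ⟨∑ i, n i * m i, by push_cast; ring⟩

theorem planeWave_halfVec_intVec (n : Fin d → ℤ) : planeWave (halfVec d) (intVec n) = sign n := by
  have : (inner ℝ (halfVec d) (intVec n) : ℝ) = ((∑ i, n i : ℤ) : ℝ) / 2 := by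
    simp [intVec, halfVec, PiLp.inner_apply, Finset.sum_mul, div_eq_mul_inv]
  have h2 : (2 * Real.pi * Complex.I * ((((∑ i, n i : ℤ) : ℝ) / 2 : ℝ) : ℂ) : ℂ) =
      ((∑ i, n i : ℤ) : ℂ) * (Real.pi * Complex.I) := by
    push_cast; ring
  rw [planeWave, this, h2, Complex.exp_int_mul, Complex.exp_pi_mul_I, sign]

theorem sign_add (m n : Fin d → ℤ) : sign (m + n) = sign m * sign n := by
  simp [sign, Finset.sum_add_distrib, zpow_add₀]

@[simp]
theorem sign_zero : sign (0 : Fin d → ℤ) = 1 := by simp [sign]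

theorem sign_eq_one_or (n : Fin d → ℤ) : sign n = 1 ∨ sign n = -1 := by
  rcases Int.even_or_odd (∑ i, n i) with h | h
  · exact Or.inl h.neg_one_zpow
  · exact Or.inr h.neg_one_zpow

theorem sign_mul_self (n : Fin d → ℤ) : sign n * sign n = 1 := by
  rcases sign_eq_one_or n with h | h <;> simp [h]

@[simp]
theorem sign_neg (n : Fin d → ℤ) : sign (-n) = sign n := by
  rcases Int.even_or_odd (∑ i, n i) with h | h
  · simp [sign, h.neg_one_zpow]
  · simp [sign, h.neg_one_zpow]

theorem conj_sign (n : Fin d → ℤ) : starRingEnd ℂ (sign n) = sign n := by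
  rcases sign_eq_one_or n with h | h <;> simp [h]

/-- Translation as a linear isometry. -/
noncomputable def translateₗᵢ (a : EuclideanSpace ℝ (Fin d)) : L2 d →ₗᵢ[ℂ] L2 d :=
  Lp.compMeasurePreservingₗᵢ ℂ (fun x => x - a) (measurePreserving_sub_right volume a)

@[simp]
theorem translateₗᵢ_apply (a : EuclideanSpace ℝ (Fin d)) (f : L2 d) :
    translateₗᵢ a f = translate a f := rfl

theorem coeFn_translate (a : EuclideanSpace ℝ (Fin d)) (f : L2 d) :
    translate a f =ᵐ[volume] fun x => f (x - a) :=
  Lp.coeFn_compMeasurePreserving f (measurePreserving_sub_right volume a)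

theorem coeFn_modulate (ω : EuclideanSpace ℝ (Fin d)) (f : L2 d) :
    modulate ω f =ᵐ[volume] fun x => planeWave ω x * f x :=
  (memLp_modulate ω f).coeFn_toLp

/-- Modulation as a linear isometry. -/
noncomputable def modulateₗᵢ (ω : EuclideanSpace ℝ (Fin d)) : L2 d →ₗᵢ[ℂ] L2 d where
  toFun := modulate ω
  map_add' f g := by
    apply Lp.ext
    filter_upwards [coeFn_modulate ω (f + g), coeFn_modulate ω f, coeFn_modulate ω g,
      Lp.coeFn_add f g, Lp.coeFn_add (modulate ω f) (modulate ω g)] with x h1 h2 h3 h4 h5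
    rw [h1, h5, Pi.add_apply, h2, h3, h4, Pi.add_apply, mul_add]
  map_smul' c f := by
    apply Lp.ext
    filter_upwards [coeFn_modulate ω (c • f), coeFn_modulate ω f,
      Lp.coeFn_smul c f, Lp.coeFn_smul c (modulate ω f)] with x h1 h2 h3 h4
    rw [RingHom.id_apply, h1, h4, Pi.smul_apply, h2, h3, Pi.smul_apply, smul_eq_mul, smul_eq_mul]
    ring
  norm_map' f := by
    change ‖modulate ω f‖ = ‖f‖
    rw [Lp.norm_def, Lp.norm_def]
    congr 1
    refine eLpNorm_congr_norm_ae ?_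
    filter_upwards [coeFn_modulate ω f] with x h
    rw [h, norm_mul, norm_planeWave, one_mul]

@[simp]
theorem modulateₗᵢ_apply (a : EuclideanSpace ℝ (Fin d)) (f : L2 d) :
    modulateₗᵢ a f = modulate a f := rfl

theorem ae_sub_right {p : EuclideanSpace ℝ (Fin d) → Prop} (h : ∀ᵐ x, p x)
    (a : EuclideanSpace ℝ (Fin d)) : ∀ᵐ x, p (x - a) :=
  (measurePreserving_sub_right volume a).quasiMeasurePreserving.ae h

theorem ae_add_right {p : EuclideanSpace ℝ (Fin d) → Prop} (h : ∀ᵐ x, p x)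
    (a : EuclideanSpace ℝ (Fin d)) : ∀ᵐ x, p (x + a) :=
  (measurePreserving_add_right volume a).quasiMeasurePreserving.ae h

theorem translate_translate (a b : EuclideanSpace ℝ (Fin d)) (f : L2 d) :
    translate a (translate b f) = translate (b + a) f := by
  apply Lp.ext
  filter_upwards [coeFn_translate a (translate b f), ae_sub_right (coeFn_translate b f) a,
    coeFn_translate (b + a) f] with x h1 h2 h3
  rw [h1, h2, h3]
  congr 1
  abel

theorem modulate_modulate (a b : EuclideanSpace ℝ (Fin d)) (f : L2 d) :
    modulate a (modulate b f) = modulate (b + a) f := by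
  apply Lp.ext
  filter_upwards [coeFn_modulate a (modulate b f), coeFn_modulate b f,
    coeFn_modulate (b + a) f] with x h1 h2 h3
  rw [h1, h2, h3, planeWave_add_left]
  ring

theorem modulate_translate (ω a : EuclideanSpace ℝ (Fin d)) (f : L2 d) :
    modulate ω (translate a f) = planeWave ω a • translate a (modulate ω f) := by
  apply Lp.ext
  filter_upwards [coeFn_modulate ω (translate a f), coeFn_translate a f,
    Lp.coeFn_smul (planeWave ω a) (translate a (modulate ω f)),
    coeFn_translate a (modulate ω f), ae_sub_right (coeFn_modulate ω f) a] with x h1 h2 h3 h4 h5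
  rw [h1, h2, h3, Pi.smul_apply, h4, h5, smul_eq_mul, ← mul_assoc, ← planeWave_add_right]
  congr 2
  abel

@[simp]
theorem modulate_zero (f : L2 d) : modulate 0 f = f := by
  apply Lp.ext
  filter_upwards [coeFn_modulate 0 f] with x h1
  rw [h1, planeWave_zero_left, one_mul]

@[simp]
theorem translate_zero (f : L2 d) : translate 0 f = f := by
  apply Lp.ext
  filter_upwards [coeFn_translate 0 f] with x h1
  rw [h1, sub_zero]

theorem translate_toLp (a : EuclideanSpace ℝ (Fin d))
    (f : SchwartzMap (EuclideanSpace ℝ (Fin d)) ℂ) :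
    translate a (f.toLp 2) = (SchwartzMap.compSubConstCLM ℂ a f).toLp 2 := by
  apply Lp.ext
  filter_upwards [coeFn_translate a (f.toLp 2), ae_sub_right (f.coeFn_toLp 2 volume) a,
    (SchwartzMap.compSubConstCLM ℂ a f).coeFn_toLp 2 volume] with x h1 h2 h3
  rw [h1, h2, h3, SchwartzMap.compSubConstCLM_apply]

theorem fourier_comp_sub (a : EuclideanSpace ℝ (Fin d)) (f : EuclideanSpace ℝ (Fin d) → ℂ)
    (w : EuclideanSpace ℝ (Fin d)) :
    𝓕 (fun x => f (x - a)) w = planeWave (-a) w * 𝓕 f w := by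
  have h := congr_fun (VectorFourier.fourierIntegral_comp_add_right Real.fourierChar
    (volume : Measure (EuclideanSpace ℝ (Fin d))) (innerₗ _) f (-a)) w
  have h2 : ((Real.fourierChar ((innerₗ (EuclideanSpace ℝ (Fin d))) (-a) w) : Circle) : ℂ) =
      planeWave (-a) w := by
    rw [Real.fourierChar_apply, planeWave, innerₗ_apply_apply]
    push_cast
    ring_nf
  rw [Circle.smul_def, h2, smul_eq_mul] at h
  exact h

/-- Both sides are continuous in `f`, and for Schwartz functions the identity is a change of
variables. -/
theorem fourier_translate (a : EuclideanSpace ℝ (Fin d)) (f : L2 d) :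
    (𝓕 (translate a f) : L2 d) = modulate (-a) (𝓕 f) := by
  refine DenseRange.induction_on
    (p := fun f : L2 d => (𝓕 (translate a f) : L2 d) = modulate (-a) (𝓕 f))
    (SchwartzMap.denseRange_toLpCLM (p := 2) ENNReal.ofNat_ne_top) f ?_ ?_
  · refine isClosed_eq ?_ ?_
    · exact (Lp.fourierTransformₗᵢ _ ℂ).continuous.comp (translateₗᵢ a).continuous
    · exact (modulateₗᵢ (-a)).continuous.comp (Lp.fourierTransformₗᵢ _ ℂ).continuous
  · intro f
    rw [SchwartzMap.toLpCLM_apply, translate_toLp, SchwartzMap.toLp_fourier_eq,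
      SchwartzMap.toLp_fourier_eq]
    apply Lp.ext
    filter_upwards [coeFn_modulate (-a) ((𝓕 f).toLp 2), (𝓕 f).coeFn_toLp 2 volume,
      (𝓕 (SchwartzMap.compSubConstCLM ℂ a f)).coeFn_toLp 2 volume] with x h1 h2 h3
    rw [h1, h2, h3, SchwartzMap.fourier_coe, SchwartzMap.fourier_coe, ← fourier_comp_sub]
    rfl

/-- The companion of `fourier_translate` for the inverse transform; it yields the transform of a
modulated function by inversion. -/
theorem fourierInv_translate (a : EuclideanSpace ℝ (Fin d)) (f : L2 d) :
    (𝓕⁻ (translate a f) : L2 d) = modulate a (𝓕⁻ f) := by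
  refine DenseRange.induction_on
    (p := fun f : L2 d => (𝓕⁻ (translate a f) : L2 d) = modulate a (𝓕⁻ f))
    (SchwartzMap.denseRange_toLpCLM (p := 2) ENNReal.ofNat_ne_top) f ?_ ?_
  · refine isClosed_eq ?_ ?_
    · exact (Lp.fourierTransformₗᵢ _ ℂ).symm.continuous.comp (translateₗᵢ a).continuous
    · exact (modulateₗᵢ a).continuous.comp (Lp.fourierTransformₗᵢ _ ℂ).symm.continuous
  · intro f
    rw [SchwartzMap.toLpCLM_apply, translate_toLp, SchwartzMap.toLp_fourierInv_eq,
      SchwartzMap.toLp_fourierInv_eq]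
    apply Lp.ext
    filter_upwards [coeFn_modulate a ((𝓕⁻ f).toLp 2), (𝓕⁻ f).coeFn_toLp 2 volume,
      (𝓕⁻ (SchwartzMap.compSubConstCLM ℂ a f)).coeFn_toLp 2 volume] with x h1 h2 h3
    rw [h1, h2, h3, SchwartzMap.fourierInv_coe, SchwartzMap.fourierInv_coe,
      Real.fourierInv_eq_fourier_neg, Real.fourierInv_eq_fourier_neg]
    have h4 := fourier_comp_sub a f (-x)
    rw [planeWave_neg_right, neg_neg] at h4
    exact h4

theorem fourier_modulate (a : EuclideanSpace ℝ (Fin d)) (f : L2 d) :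
    (𝓕 (modulate a f) : L2 d) = translate a (𝓕 f) := by
  have h := fourierInv_translate a (𝓕 f)
  rw [fourierInv_fourier_eq] at h
  rw [← h, fourier_fourierInv_eq]

end TimeFrequency

/-! ### Fourier series on the unit cube -/

section Cube

variable {d : ℕ}

/-- The half-open unit cube `(0, 1]ᵈ`. -/
def unitCube (d : ℕ) : Set (EuclideanSpace ℝ (Fin d)) :=
  {x | ∀ i, x i ∈ Set.Ioc (0 : ℝ) 1}

/-- The translate of the unit cube by the integer vector `k`. -/
def intCube (k : Fin d → ℤ) : Set (EuclideanSpace ℝ (Fin d)) :=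
  (fun x => x - intVec k) ⁻¹' unitCube d

theorem measurableSet_unitCube : MeasurableSet (unitCube d) := by
  have : unitCube d = ⋂ i, (fun x : EuclideanSpace ℝ (Fin d) => x i) ⁻¹' Set.Ioc (0 : ℝ) 1 := by
    ext x; simp [unitCube]
  rw [this]
  refine MeasurableSet.iInter fun i => measurableSet_Ioc.preimage ?_
  fun_prop

theorem measurableSet_intCube (k : Fin d → ℤ) : MeasurableSet (intCube k) :=
  measurableSet_unitCube.preimage (by fun_prop)

theorem mem_intCube_iff {k : Fin d → ℤ} {x : EuclideanSpace ℝ (Fin d)} :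
    x ∈ intCube k ↔ k = fun i => ⌈x i⌉ - 1 := by
  simp only [intCube, unitCube, Set.mem_preimage, Set.mem_ofPred_eq, funext_iff, Set.mem_Ioc]
  refine forall_congr' fun i => ?_
  have h : (x - intVec k) i = x i - k i := by simp [intVec]
  rw [h, eq_sub_iff_add_eq, eq_comm, Int.ceil_eq_iff]
  push_cast
  constructor <;> rintro ⟨h1, h2⟩ <;> constructor <;> linarith

theorem iUnion_intCube : ⋃ k : Fin d → ℤ, intCube k = Set.univ := by
  ext x
  simp [mem_intCube_iff]

theorem pairwise_disjoint_intCube :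
    Pairwise (Function.onFun Disjoint (intCube : (Fin d → ℤ) → _)) := by
  intro k l hkl
  rw [Function.onFun, Set.disjoint_left]
  intro x hx hx'
  exact hkl ((mem_intCube_iff.1 hx).trans (mem_intCube_iff.1 hx').symm)

theorem setIntegral_intCube (k : Fin d → ℤ) (f : EuclideanSpace ℝ (Fin d) → ℂ) :
    ∫ x in intCube k, f x = ∫ x in unitCube d, f (x + intVec k) := by
  have h := (measurePreserving_add_right (volume : Measure (EuclideanSpace ℝ (Fin d)))
    (intVec k)).setIntegral_preimage_emb (measurableEmbedding_addRight _) f (intCube k)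
  rw [← h]
  congr 2
  ext x
  simp [intCube]

theorem hasSum_setIntegral_unitCube {f : EuclideanSpace ℝ (Fin d) → ℂ} (hf : Integrable f) :
    HasSum (fun k : Fin d → ℤ => ∫ x in unitCube d, f (x + intVec k)) (∫ x, f x) := by
  have h := hasSum_integral_iUnion (μ := volume) (f := f)
    (measurableSet_intCube (d := d)) pairwise_disjoint_intCube hf.integrableOn
  rw [iUnion_intCube, setIntegral_univ] at h
  simpa only [setIntegral_intCube] using h

/-- The circle `ℝ / ℤ` carries its Haar probability measure, as in Mathlib's theory of Fourier
series on the torus. -/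
noncomputable local instance : MeasureSpace UnitAddCircle := ⟨AddCircle.haarAddCircle⟩

local instance : IsProbabilityMeasure (volume : Measure UnitAddCircle) :=
  inferInstanceAs (IsProbabilityMeasure AddCircle.haarAddCircle)

/-- The section of the quotient map `ℝᵈ → (ℝ / ℤ)ᵈ` with values in the unit cube. -/
noncomputable def torusToCube (t : UnitAddTorus (Fin d)) : EuclideanSpace ℝ (Fin d) :=
  WithLp.toLp 2 (UnitAddTorus.measurableEquivPiIoc (fun _ => (0 : ℝ)) t).1

theorem measurePreserving_torusToCube :
    MeasurePreserving (torusToCube (d := d)) volume (volume.restrict (unitCube d)) := by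
  have h1 := UnitAddTorus.measurePreserving_equivPiIoc (d := Fin d) (fun _ => (0 : ℝ))
  have hm : MeasurableSet {x : Fin d → ℝ | ∀ i, x i ∈ Set.Ioc (0 : ℝ) (0 + 1)} :=
    MeasurableSet.univ_pi' fun i => measurableSet_Ioc
  have h2 := measurePreserving_subtype_coe (μa := (volume : Measure (Fin d → ℝ))) hm
  have h3 := (PiLp.volume_preserving_toLp (Fin d)).restrict_preimage
    (measurableSet_unitCube (d := d))
  have h4 : (WithLp.toLp 2 : (Fin d → ℝ) → EuclideanSpace ℝ (Fin d)) ⁻¹' unitCube d =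
      {x : Fin d → ℝ | ∀ i, x i ∈ Set.Ioc (0 : ℝ) (0 + 1)} := by
    ext x; simp [unitCube]
  rw [h4] at h3
  exact h3.comp (h2.comp h1)

theorem volume_unitCube :
    (volume : Measure (EuclideanSpace ℝ (Fin d))) (unitCube d) = 1 := by
  have h := (measurePreserving_torusToCube (d := d)).measure_preimage
    (s := Set.univ) MeasurableSet.univ.nullMeasurableSet
  rw [Measure.restrict_apply_univ] at h
  rw [← h]
  exact measure_univ

theorem mFourier_eq_planeWave (n : Fin d → ℤ) (t : UnitAddTorus (Fin d)) :
    UnitAddTorus.mFourier n t = planeWave (intVec n) (torusToCube t) := by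
  have ht : t = fun i => ((torusToCube t i : ℝ) : UnitAddCircle) :=
    ((UnitAddTorus.measurableEquivPiIoc (fun _ => (0 : ℝ))).symm_apply_apply t).symm
  conv_lhs => rw [ht]
  simp only [UnitAddTorus.mFourier, ContinuousMap.coe_mk, fourier_coe_apply, planeWave]
  rw [← Complex.exp_sum]
  congr 1
  simp only [intVec, PiLp.inner_apply, Finset.mul_sum, Complex.ofReal_sum]
  refine Finset.sum_congr rfl fun i _ => ?_
  simp
  ring

/-- **Parseval's identity** for Fourier series on the unit cube. -/
theorem hasSum_parseval_unitCube {u v : EuclideanSpace ℝ (Fin d) → ℂ}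
    (hu : MemLp u 2 (volume.restrict (unitCube d)))
    (hv : MemLp v 2 (volume.restrict (unitCube d))) :
    HasSum (fun n : Fin d → ℤ =>
      starRingEnd ℂ (∫ x in unitCube d, planeWave (-intVec n) x * u x) *
        ∫ x in unitCube d, planeWave (-intVec n) x * v x)
      (∫ x in unitCube d, starRingEnd ℂ (u x) * v x) := by
  have he := measurePreserving_torusToCube (d := d)
  have hU := hu.comp_measurePreserving he
  have hV := hv.comp_measurePreserving he
  have h := UnitAddTorus.hasSum_prod_mFourierCoeff (hU.toLp _) (hV.toLp _)
  have hint : ∀ {w : EuclideanSpace ℝ (Fin d) → ℂ},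
      AEStronglyMeasurable w (volume.restrict (unitCube d)) →
      ∫ t : UnitAddTorus (Fin d), w (torusToCube t) = ∫ x in unitCube d, w x := by
    intro w hw
    rw [← he.map_eq] at hw ⊢
    exact (integral_map he.measurable.aemeasurable hw).symm
  have hcoef : ∀ {w : EuclideanSpace ℝ (Fin d) → ℂ}
      (hw : MemLp w 2 (volume.restrict (unitCube d))) (n : Fin d → ℤ),
      UnitAddTorus.mFourierCoeff ((hw.comp_measurePreserving he).toLp _) n =
        ∫ x in unitCube d, planeWave (-intVec n) x * w x := by
    intro w hw n
    refine Eq.trans ?_ (hint (w := fun x => planeWave (-intVec n) x * w x)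
      ((continuous_planeWave _).aestronglyMeasurable.mul hw.aestronglyMeasurable))
    refine integral_congr_ae ?_
    filter_upwards [(hw.comp_measurePreserving he).coeFn_toLp] with t ht
    rw [ht, mFourier_eq_planeWave, intVec_neg]
    rfl
  simp only [hcoef hu, hcoef hv] at h
  convert h using 1
  refine (hint (w := fun x => starRingEnd ℂ (u x) * v x)
    ((Complex.continuous_conj.comp_aestronglyMeasurable hu.aestronglyMeasurable).mul
      hv.aestronglyMeasurable)).symm.trans ?_
  refine integral_congr_ae ?_
  filter_upwards [hU.coeFn_toLp, hV.coeFn_toLp] with t h1 h2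
  rw [h1, h2]
  rfl

theorem memLp_planeWave_mul (a : EuclideanSpace ℝ (Fin d))
    {μ : Measure (EuclideanSpace ℝ (Fin d))} {u : EuclideanSpace ℝ (Fin d) → ℂ}
    (hu : MemLp u 2 μ) : MemLp (fun x => planeWave a x * u x) 2 μ := by
  refine hu.of_le ((continuous_planeWave a).aestronglyMeasurable.mul hu.aestronglyMeasurable)
    (Filter.Eventually.of_forall fun x => ?_)
  rw [norm_mul, norm_planeWave, one_mul]

theorem memLp_comp_add (G : L2 d) (a : EuclideanSpace ℝ (Fin d)) :
    MemLp (fun x => G (x + a)) 2 volume :=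
  (Lp.memLp G).comp_measurePreserving (measurePreserving_add_right volume a)

/-- The Fourier integral at the frequency `a` of the function `x ↦ G (x + p)` on the unit cube. -/
noncomputable def cubeCoeff (G : L2 d) (a : EuclideanSpace ℝ (Fin d)) (p : Fin d → ℤ) : ℂ :=
  ∫ x in unitCube d, planeWave (-a) x * G (x + intVec p)

/-- The inner product over the unit cube of `x ↦ G (x + p)` and `x ↦ H (x + q)`, weighted by a
plane wave of frequency `a`. -/
noncomputable def cubeInner (G H : L2 d) (a : EuclideanSpace ℝ (Fin d)) (p q : Fin d → ℤ) : ℂ :=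
  ∫ x in unitCube d, planeWave a x * (starRingEnd ℂ (G (x + intVec p)) * H (x + intVec q))

/-- Parseval's identity for two translates, also along a shifted lattice of frequencies `b + ℤᵈ`. -/
theorem hasSum_cubeCoeff (G H : L2 d) (b b' : EuclideanSpace ℝ (Fin d)) (p q : Fin d → ℤ) :
    HasSum (fun l : Fin d → ℤ =>
      starRingEnd ℂ (cubeCoeff G (b + intVec l) p) * cubeCoeff H (b' + intVec l) q)
      (cubeInner G H (b - b') p q) := by
  have h := hasSum_parseval_unitCube
    (memLp_planeWave_mul (-b) ((memLp_comp_add G (intVec p)).restrict (unitCube d)))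
    (memLp_planeWave_mul (-b') ((memLp_comp_add H (intVec q)).restrict (unitCube d)))
  convert h using 1
  · funext l
    simp only [cubeCoeff, neg_add, planeWave_add_left]
    congr 3 <;> funext x <;> ring
  · refine integral_congr_ae (Filter.Eventually.of_forall fun x => ?_)
    simp only [sub_eq_add_neg, planeWave_add_left, map_mul, conj_planeWave, neg_neg]
    ring

theorem hasSum_norm_cubeCoeff_sq (G : L2 d) (b : EuclideanSpace ℝ (Fin d)) (p : Fin d → ℤ) :
    HasSum (fun l : Fin d → ℤ => ‖cubeCoeff G (b + intVec l) p‖ ^ 2) (cubeInner G G 0 p p).re := by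
  have h := Complex.hasSum_re (hasSum_cubeCoeff G G b b p p)
  rw [sub_self] at h
  convert h using 1
  funext l
  rw [RCLike.conj_mul]
  norm_cast

theorem integrable_conj_mul_comp_add (G H : L2 d) (a : EuclideanSpace ℝ (Fin d)) :
    Integrable (fun x => starRingEnd ℂ (G x) * H (x + a)) := by
  refine MemLp.integrable_mul (p := 2) (q := 2) ?_ (memLp_comp_add H a)
  exact (Lp.memLp G).star

/-- The integer translates of the unit cube tile the space, so that an inner product over the space
is the sum of the inner products over the cubes. -/
theorem hasSum_cubeInner (G H : L2 d) (m : Fin d → ℤ) :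
    HasSum (fun k : Fin d → ℤ => cubeInner G H 0 k (m + k))
      (∫ x, starRingEnd ℂ (G x) * H (x + intVec m)) := by
  convert hasSum_setIntegral_unitCube (integrable_conj_mul_comp_add G H (intVec m)) using 1
  funext k
  simp only [cubeInner, planeWave_zero_left, one_mul, intVec_add]
  refine integral_congr_ae (Filter.Eventually.of_forall fun x => ?_)
  simp only
  congr 2
  abel_nf

/-- For real `G` the weighted inner products of its translates are symmetric. -/
theorem cubeInner_comm {G : L2 d} (hG : ∀ᵐ x, G x = starRingEnd ℂ (G x))
    (a : EuclideanSpace ℝ (Fin d)) (p q : Fin d → ℤ) :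
    cubeInner G G a p q = cubeInner G G a q p := by
  refine integral_congr_ae (ae_restrict_of_ae ?_)
  filter_upwards [ae_add_right hG (intVec p), ae_add_right hG (intVec q)] with x h1 h2
  rw [← h1, ← h2, mul_comm (G _)]

end Cube

/-! ### Wave packets adapted to the integer cubes -/

section Atoms

variable {d : ℕ}

theorem memLp_indicator_planeWave (k n : Fin d → ℤ) :
    MemLp ((intCube k).indicator (planeWave (intVec n))) 2
      (volume : Measure (EuclideanSpace ℝ (Fin d))) := by
  have h2 : (volume : Measure (EuclideanSpace ℝ (Fin d))) (intCube k) < ⊤ := by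
    rw [intCube, (measurePreserving_sub_right volume (intVec k)).measure_preimage
      measurableSet_unitCube.nullMeasurableSet]
    exact volume_unitCube.trans_lt ENNReal.one_lt_top
  rw [memLp_indicator_iff_restrict (measurableSet_intCube k)]
  have : IsFiniteMeasure (volume.restrict (intCube k)) := ⟨by simpa using h2⟩
  exact MemLp.of_bound (continuous_planeWave _).aestronglyMeasurable 1
    (Filter.Eventually.of_forall fun x => (norm_planeWave _ x).le)

/-- The function whose Fourier transform is the plane wave of frequency `n`, cut off to the
integer cube with corner `k`. -/
noncomputable def atom (k n : Fin d → ℤ) : L2 d :=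
  𝓕⁻ ((memLp_indicator_planeWave k n).toLp _ : L2 d)

theorem inner_atom (k n : Fin d → ℤ) (f : L2 d) :
    inner ℂ (atom k n) f = cubeCoeff (𝓕 f) (intVec n) k := by
  have h1 : inner ℂ (atom k n) f =
      ∫ x, (intCube k).indicator (fun x => planeWave (-intVec n) x * (𝓕 f : L2 d) x) x := by
    rw [← Lp.inner_fourier_eq, atom, fourier_fourierInv_eq, L2.inner_def]
    refine integral_congr_ae ?_
    filter_upwards [(memLp_indicator_planeWave k n).coeFn_toLp] with x hx
    rw [hx, RCLike.inner_apply]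
    by_cases h : x ∈ intCube k
    · rw [Set.indicator_of_mem h, Set.indicator_of_mem h, conj_planeWave, mul_comm]
    · rw [Set.indicator_of_notMem h, Set.indicator_of_notMem h, map_zero, mul_zero]
  rw [h1, integral_indicator (measurableSet_intCube k), setIntegral_intCube, cubeCoeff]
  refine integral_congr_ae (Filter.Eventually.of_forall fun x => ?_)
  simp only [planeWave_add_right, ← intVec_neg, planeWave_intVec_intVec, mul_one]

theorem integral_conj_mul_comp_add (G H : L2 d) (a : EuclideanSpace ℝ (Fin d)) :
    ∫ x, starRingEnd ℂ (G x) * H (x + a) = inner ℂ G (translate (-a) H) := by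
  rw [L2.inner_def]
  refine integral_congr_ae ?_
  filter_upwards [coeFn_translate (-a) H] with x hx
  rw [hx, RCLike.inner_apply, sub_neg_eq_add, mul_comm]

/-- The wave packets span a dense subspace, by Parseval's identity on each cube. -/
theorem dense_span_atom :
    Dense (Submodule.span ℂ (Set.range fun p : (Fin d → ℤ) × (Fin d → ℤ) => atom p.1 p.2) :
      Set (L2 d)) := by
  rw [Submodule.dense_iff_topologicalClosure_eq_top, Submodule.topologicalClosure_eq_top_iff,
    Submodule.eq_bot_iff]
  intro f hf
  have h0 : ∀ k n : Fin d → ℤ, cubeCoeff (𝓕 f) (intVec n) k = 0 := fun k n => by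
    rw [← inner_atom]
    exact Submodule.inner_right_of_mem_orthogonal
      (Submodule.subset_span (Set.mem_range_self (k, n))) hf
  have h1 : ∀ k : Fin d → ℤ, cubeInner (𝓕 f) (𝓕 f) 0 k (0 + k) = 0 := fun k => by
    have := hasSum_cubeCoeff (𝓕 f : L2 d) (𝓕 f) 0 0 k k
    simp only [zero_add, h0, mul_zero, sub_zero] at this ⊢
    exact this.unique hasSum_zero
  have h2 := hasSum_cubeInner (𝓕 f : L2 d) (𝓕 f) 0
  simp only [h1, integral_conj_mul_comp_add] at h2
  have h3 := h2.unique hasSum_zero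
  rw [intVec_zero, neg_zero, translate_zero, inner_self_eq_zero] at h3
  exact (Lp.fourierTransformₗᵢ _ ℂ).map_eq_zero_iff.1 h3

/-- The two cosets of `ℤᵈ` in the set of shifts, represented by `0` and `1/2`. -/
noncomputable def cosetVec (d : ℕ) (ε : Bool) : EuclideanSpace ℝ (Fin d) :=
  if ε then halfVec d else 0

/-- The value at the integer vector `k` of the plane wave of frequency `cosetVec d ε`. -/
noncomputable def cosetSign (ε : Bool) (k : Fin d → ℤ) : ℂ :=
  if ε then sign k else 1

/-- The Gabor system, indexed by the coset of the shift, the frequency and the integral part of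
the shift. -/
noncomputable def gaborElt (g : L2 d) (ε : Bool) (p : (Fin d → ℤ) × (Fin d → ℤ)) : L2 d :=
  translate (cosetVec d ε + intVec p.2) (modulate (intVec p.1) g)

theorem planeWave_cosetVec_intVec (ε : Bool) (k : Fin d → ℤ) :
    planeWave (cosetVec d ε) (intVec k) = cosetSign ε k := by
  cases ε
  · simp [cosetVec, cosetSign]
  · simp [cosetVec, cosetSign, planeWave_halfVec_intVec]

theorem conj_cosetSign (ε : Bool) (k : Fin d → ℤ) :
    starRingEnd ℂ (cosetSign ε k) = cosetSign ε k := by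
  cases ε <;> simp [cosetSign, conj_sign]

theorem norm_cosetSign (ε : Bool) (k : Fin d → ℤ) : ‖cosetSign ε k‖ = 1 := by
  rw [← planeWave_cosetVec_intVec, norm_planeWave]

theorem planeWave_neg_cosetVec_intVec (ε : Bool) (k : Fin d → ℤ) :
    planeWave (-cosetVec d ε) (intVec k) = cosetSign ε k := by
  rw [← conj_planeWave, planeWave_cosetVec_intVec, conj_cosetSign]

theorem inner_atom_gaborElt (k n : Fin d → ℤ) (g : L2 d) (ε : Bool) (γ l : Fin d → ℤ) :
    inner ℂ (atom k n) (gaborElt g ε (γ, l)) =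
      cosetSign ε k * cubeCoeff (𝓕 g) (cosetVec d ε + intVec n + intVec l) (k - γ) := by
  rw [inner_atom, gaborElt, fourier_translate, fourier_modulate, cubeCoeff, cubeCoeff,
    ← integral_const_mul]
  refine integral_congr_ae (ae_restrict_of_ae ?_)
  filter_upwards [ae_add_right (coeFn_modulate (-(cosetVec d ε + intVec l))
      (translate (intVec γ) (𝓕 g))) (intVec k),
    ae_add_right (coeFn_translate (intVec γ) (𝓕 g : L2 d)) (intVec k)] with x h1 h2
  rw [h1, h2, planeWave_add_right]
  simp only [neg_add, planeWave_add_left, ← intVec_neg, planeWave_intVec_intVec,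
    planeWave_neg_cosetVec_intVec]
  rw [intVec_sub, add_sub_assoc]
  ring

/-- Parseval's identity for the coefficients of two wave packets, summed over all shifts in one
coset for a fixed pair of frequencies. -/
theorem hasSum_inner_gaborElt_mul (g h : L2 d) (ε : Bool) (k n k' n' γ γ' : Fin d → ℤ) :
    HasSum (fun l => inner ℂ (gaborElt g ε (γ, l)) (atom k n) *
        inner ℂ (atom k' n') (gaborElt h ε (γ', l)))
      (cosetSign ε k * cosetSign ε k' *
        cubeInner (𝓕 g) (𝓕 h) (intVec (n - n')) (k - γ) (k' - γ')) := by
  have := (hasSum_cubeCoeff (𝓕 g : L2 d) (𝓕 h) (cosetVec d ε + intVec n)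
    (cosetVec d ε + intVec n') (k - γ) (k' - γ')).mul_left (cosetSign ε k * cosetSign ε k')
  rw [add_sub_add_left_eq_sub, ← intVec_sub] at this
  refine this.congr_fun fun l => ?_
  rw [← inner_conj_symm, inner_atom_gaborElt, inner_atom_gaborElt, map_mul, conj_cosetSign]
  ring

/-- The coefficients of a wave packet are square summable for every window `g`: summed over the
shifts and all frequencies, they give `‖g‖²`. -/
theorem summable_norm_inner_gaborElt_atom (g : L2 d) (ε : Bool) (k n : Fin d → ℤ) :
    Summable fun p => ‖inner ℂ (gaborElt g ε p) (atom k n)‖ ^ 2 := by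
  have h : ∀ γ : Fin d → ℤ, HasSum (fun l => ‖inner ℂ (gaborElt g ε (γ, l)) (atom k n)‖ ^ 2)
      (cubeInner (𝓕 g) (𝓕 g) 0 (k - γ) (k - γ)).re := fun γ => by
    convert hasSum_norm_cubeCoeff_sq (𝓕 g : L2 d) (cosetVec d ε + intVec n) (k - γ) using 2 with l
    rw [norm_inner_symm, inner_atom_gaborElt, norm_mul, norm_cosetSign, one_mul]
  refine (summable_prod_of_nonneg fun p => by positivity).2 ⟨fun γ => (h γ).summable, ?_⟩
  simp only [(h _).tsum_eq]
  have h2 := (Complex.hasSum_re (hasSum_cubeInner (𝓕 g : L2 d) (𝓕 g) 0)).summable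
  simp only [zero_add] at h2
  exact (Equiv.subLeft k).summable_iff.2 h2

theorem summable_mul_of_summable_norm_sq {ι : Type*} {u v : ι → ℂ}
    (hu : Summable fun i => ‖u i‖ ^ 2) (hv : Summable fun i => ‖v i‖ ^ 2) :
    Summable fun i => u i * v i := by
  refine Summable.of_norm_bounded (hu.add hv) fun i => ?_
  rw [norm_mul]
  nlinarith [sq_nonneg (‖u i‖ - ‖v i‖), sq_nonneg (‖u i‖), sq_nonneg (‖v i‖)]

/-- The map `(γ, l) ↦ (-γ, l)` on pairs of integer vectors. -/
def negFst : (Fin d → ℤ) × (Fin d → ℤ) ≃ (Fin d → ℤ) × (Fin d → ℤ) :=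
  (Equiv.neg _).prodCongr (Equiv.refl _)

@[simp]
theorem negFst_apply (p : (Fin d → ℤ) × (Fin d → ℤ)) : negFst p = (-p.1, p.2) := rfl

/-- The cross terms between the frequencies `γ` and `-γ` in the difference of the quadratic forms
of the Wilson and the Gabor system, polarized. -/
noncomputable def crossTerm (g f f' : L2 d) (p : (Fin d → ℤ) × (Fin d → ℤ)) : ℂ :=
  sign p.1 * (inner ℂ (gaborElt g false p) f * inner ℂ f' (gaborElt g false (negFst p)) -
    inner ℂ (gaborElt g true p) f * inner ℂ f' (gaborElt g true (negFst p)))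

/-- The cross terms of two wave packets cancel. If the corners `k` and `k'` of their cubes have the
same parity, the contributions of the two cosets agree. Otherwise the substitution
`γ ↦ k - k' - γ` exchanges the two arguments of the symmetric expression
`cubeInner _ _ _ (k - γ) (k' + γ)` and reverses the sign of `γ`. -/
theorem hasSum_crossTerm_atom {g : L2 d}
    (hg : ∀ᵐ ω, (𝓕 g : L2 d) ω = starRingEnd ℂ ((𝓕 g : L2 d) ω)) (k n k' n' : Fin d → ℤ) :
    HasSum (crossTerm g (atom k n) (atom k' n')) 0 := by
  have hs : ∀ ε, Summable fun p => inner ℂ (gaborElt g ε p) (atom k n) *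
      inner ℂ (atom k' n') (gaborElt g ε (negFst p)) := fun ε => by
    refine summable_mul_of_summable_norm_sq (summable_norm_inner_gaborElt_atom g ε k n) ?_
    simp only [norm_inner_symm (atom k' n')]
    exact negFst.summable_iff.2 (summable_norm_inner_gaborElt_atom g ε k' n')
  have hsum : Summable (crossTerm g (atom k n) (atom k' n')) := by
    refine Summable.of_norm ((((hs false).sub (hs true)).norm).congr fun p => ?_)
    rw [crossTerm, norm_mul]
    rcases sign_eq_one_or p.1 with h | h <;> simp [h]
  set c := cubeInner (𝓕 g : L2 d) (𝓕 g) (intVec (n - n')) with hc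
  have hfib : ∀ γ : Fin d → ℤ, HasSum (fun l => crossTerm g (atom k n) (atom k' n') (γ, l))
      (sign γ * (c (k - γ) (k' + γ) - sign k * sign k' * c (k - γ) (k' + γ))) := fun γ => by
    have h0 := hasSum_inner_gaborElt_mul g g false k n k' n' γ (-γ)
    have h1 := hasSum_inner_gaborElt_mul g g true k n k' n' γ (-γ)
    simp only [cosetSign, sub_neg_eq_add, if_true, Bool.false_eq_true, if_false, one_mul] at h0 h1
    exact (h0.sub h1).mul_left (sign γ)
  have hT := hsum.hasSum.prod_fiberwise hfib
  have h0 : ∑' γ : Fin d → ℤ,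
      (sign γ * (c (k - γ) (k' + γ) - sign k * sign k' * c (k - γ) (k' + γ))) = 0 := by
    set F := fun γ : Fin d → ℤ =>
      sign γ * (c (k - γ) (k' + γ) - sign k * sign k' * c (k - γ) (k' + γ)) with hF
    have hodd : ∀ γ, F (Equiv.subLeft (k - k') γ) = - F γ := fun γ => by
      have e1 : k - (k - k' - γ) = k' + γ := by abel
      have e2 : k' + (k - k' - γ) = k - γ := by abel
      have e3 : sign (k - k' - γ) = sign k * sign k' * sign γ := by
        rw [sub_eq_add_neg, sub_eq_add_neg, sign_add, sign_add, sign_neg, sign_neg]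
      simp only [hF, Equiv.subLeft_apply, e1, e2, e3]
      rw [hc, cubeInner_comm hg _ (k' + γ)]
      linear_combination (- sign γ * c (k - γ) (k' + γ)) *
        (sign k * sign k * sign_mul_self k' + sign_mul_self k)
    have h2 := (Equiv.subLeft (k - k')).tsum_eq F
    simp only [hodd, tsum_neg] at h2
    exact self_eq_neg.1 h2.symm
  rw [← hT.tsum_eq.symm.trans h0]
  exact hsum.hasSum

/-- The cross terms are sesquilinear, so that they cancel on the span of the wave packets. -/
theorem hasSum_crossTerm {g : L2 d}
    (hg : ∀ᵐ ω, (𝓕 g : L2 d) ω = starRingEnd ℂ ((𝓕 g : L2 d) ω)) {f f' : L2 d}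
    (hf : f ∈ Submodule.span ℂ (Set.range fun p : (Fin d → ℤ) × (Fin d → ℤ) => atom p.1 p.2))
    (hf' : f' ∈ Submodule.span ℂ (Set.range fun p : (Fin d → ℤ) × (Fin d → ℤ) => atom p.1 p.2)) :
    HasSum (crossTerm g f f') 0 := by
  induction hf using Submodule.span_induction with
  | mem f hf =>
    obtain ⟨⟨k, n⟩, rfl⟩ := hf
    induction hf' using Submodule.span_induction with
    | mem f' hf' =>
      obtain ⟨⟨k', n'⟩, rfl⟩ := hf'
      exact hasSum_crossTerm_atom hg k n k' n'
    | zero => exact hasSum_zero.congr_fun fun p => by simp [crossTerm]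
    | add x y _ _ hx hy =>
      have h := hx.add hy
      rw [add_zero] at h
      exact h.congr_fun fun p => by simp only [crossTerm, inner_add_left]; ring
    | smul c x _ hx =>
      have h := hx.mul_left (starRingEnd ℂ c)
      rw [mul_zero] at h
      exact h.congr_fun fun p => by simp only [crossTerm, inner_smul_left]; ring
  | zero => exact hasSum_zero.congr_fun fun p => by simp [crossTerm]
  | add x y _ _ hx hy =>
    have h := hx.add hy
    rw [add_zero] at h
    exact h.congr_fun fun p => by simp only [crossTerm, inner_add_right]; ring
  | smul c x _ hx =>
    have h := hx.mul_left c
    rw [mul_zero] at h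
    exact h.congr_fun fun p => by simp only [crossTerm, inner_smul_right]; ring

theorem summable_norm_inner_gaborElt (g : L2 d) (ε : Bool) {f : L2 d}
    (hf : f ∈ Submodule.span ℂ (Set.range fun p : (Fin d → ℤ) × (Fin d → ℤ) => atom p.1 p.2)) :
    Summable fun p => ‖inner ℂ (gaborElt g ε p) f‖ ^ 2 := by
  induction hf using Submodule.span_induction with
  | mem f hf =>
    obtain ⟨⟨k, n⟩, rfl⟩ := hf
    exact summable_norm_inner_gaborElt_atom g ε k n
  | zero => simp
  | add x y _ _ hx hy =>
    refine Summable.of_nonneg_of_le (fun p => by positivity) (fun p => ?_)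
      ((hx.mul_left 2).add (hy.mul_left 2))
    rw [inner_add_right]
    have := norm_add_le (inner ℂ (gaborElt g ε p) x : ℂ) (inner ℂ (gaborElt g ε p) y)
    have h2 := pow_le_pow_left₀ (norm_nonneg _) this 2
    nlinarith [sq_nonneg (‖(inner ℂ (gaborElt g ε p) x : ℂ)‖ - ‖(inner ℂ (gaborElt g ε p) y : ℂ)‖)]
  | smul c x _ hx =>
    refine (hx.mul_left (‖c‖ ^ 2)).congr fun p => ?_
    rw [inner_smul_right, norm_mul, mul_pow]

end Atoms

/-! ### Comparison of the quadratic forms of the two systems -/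

section Comparison

variable {d : ℕ}

theorem intVec_injective : Function.Injective (intVec : (Fin d → ℤ) → _) := by
  intro m n h
  funext i
  have := congr_arg (fun x : EuclideanSpace ℝ (Fin d) => x i) h
  simpa [intVec] using this

theorem intVec_ne_halfVec_add (hd : 0 < d) (m n : Fin d → ℤ) :
    intVec m ≠ halfVec d + intVec n := by
  intro h
  have h1 := congr_arg (fun x : EuclideanSpace ℝ (Fin d) => x ⟨0, hd⟩) h
  simp only [intVec, halfVec, PiLp.add_apply] at h1
  have h2 : (2 * m ⟨0, hd⟩ : ℤ) = 1 + 2 * n ⟨0, hd⟩ := by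
    have : (2 * m ⟨0, hd⟩ : ℝ) = 1 + 2 * n ⟨0, hd⟩ := by rw [h1]; ring
    exact_mod_cast this
  omega

/-- The two cosets of `ℤᵈ` together index the Gabor system; they are disjoint since `d > 0`. -/
noncomputable def gaborEquiv (hd : 0 < d) :
    ((Fin d → ℤ) × (Fin d → ℤ)) ⊕ ((Fin d → ℤ) × (Fin d → ℤ)) ≃ shiftSet d × (Fin d → ℤ) :=
  Equiv.ofBijective
    (Sum.elim (fun p => (⟨intVec p.2, Or.inl ⟨p.2, rfl⟩⟩, p.1))
      (fun p => (⟨halfVec d + intVec p.2, Or.inr ⟨p.2, rfl⟩⟩, p.1))) (by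
    constructor
    · rintro (⟨γ, l⟩ | ⟨γ, l⟩) (⟨γ', l'⟩ | ⟨γ', l'⟩) h <;>
        simp only [Sum.elim_inl, Sum.elim_inr, Prod.mk.injEq] at h <;>
        obtain ⟨h1, rfl⟩ := h <;> replace h1 := congr_arg Subtype.val h1
      · rw [intVec_injective h1]
      · exact absurd h1 (intVec_ne_halfVec_add hd _ _)
      · exact absurd h1.symm (intVec_ne_halfVec_add hd _ _)
      · rw [intVec_injective (add_left_cancel h1)]
    · rintro ⟨⟨_, ⟨l, rfl⟩ | ⟨l, rfl⟩⟩, γ⟩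
      · exact ⟨Sum.inl (γ, l), rfl⟩
      · exact ⟨Sum.inr (γ, l), rfl⟩)

theorem gabor_gaborEquiv_inl (hd : 0 < d) (g : L2 d) (p : (Fin d → ℤ) × (Fin d → ℤ)) :
    gabor g (gaborEquiv hd (Sum.inl p)) = gaborElt g false p := by
  change translate (intVec p.2) (modulate (intVec p.1) g) = _
  simp [gaborElt, cosetVec]

theorem gabor_gaborEquiv_inr (hd : 0 < d) (g : L2 d) (p : (Fin d → ℤ) × (Fin d → ℤ)) :
    gabor g (gaborEquiv hd (Sum.inr p)) = gaborElt g true p := by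
  change translate (halfVec d + intVec p.2) (modulate (intVec p.1) g) = _
  simp [gaborElt, cosetVec]

theorem translate_add (a : EuclideanSpace ℝ (Fin d)) (f g : L2 d) :
    translate a (f + g) = translate a f + translate a g := (translateₗᵢ a).map_add f g

theorem translate_sub (a : EuclideanSpace ℝ (Fin d)) (f g : L2 d) :
    translate a (f - g) = translate a f - translate a g := (translateₗᵢ a).map_sub f g

theorem translate_smul (a : EuclideanSpace ℝ (Fin d)) (c : ℂ) (f : L2 d) :
    translate a (c • f) = c • translate a f := (translateₗᵢ a).map_smul c f

variable {N : Set (Fin d → ℤ)}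

theorem wilson_inl (g : L2 d) (l : Fin d → ℤ) :
    wilson N g (Sum.inl l) = gaborElt g false (0, l) := by
  simp [wilson, gaborElt, cosetVec]

theorem wilson_inr_inl (g : L2 d) (l : Fin d → ℤ) (γ : N) :
    wilson N g (Sum.inr (Sum.inl (l, γ))) = ((1 / Real.sqrt 2 : ℝ) : ℂ) •
      (gaborElt g false (γ, l) + sign (γ : Fin d → ℤ) • gaborElt g false (-γ, l)) := by
  simp [wilson, gaborElt, cosetVec, translate_add, translate_smul]

theorem wilson_inr_inr (g : L2 d) (l : Fin d → ℤ) (γ : N) :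
    wilson N g (Sum.inr (Sum.inr (l, γ))) = ((1 / Real.sqrt 2 : ℝ) : ℂ) •
      (gaborElt g true (γ, l) - sign (γ : Fin d → ℤ) • gaborElt g true (-γ, l)) := by
  simp [wilson, gaborElt, cosetVec, translate_sub, translate_smul, add_comm]

/-- A set `N` of representatives of the nonzero integer vectors modulo sign unfolds the Wilson
index set to the set of all pairs of a frequency and a shift. -/
noncomputable def wilsonEquiv (hNdisj : N ∩ (-N) = ∅) (hNcover : N ∪ (-N) ∪ {0} = Set.univ) :
    WilsonIndex N ≃ (Fin d → ℤ) × (Fin d → ℤ) :=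
  Equiv.ofBijective
    (Sum.elim (fun l => (0, l)) (Sum.elim (fun q => ((q.2 : Fin d → ℤ), q.1))
      (fun q => (-(q.2 : Fin d → ℤ), q.1)))) (by
    have hdisj : ∀ x ∈ N, -x ∉ N := fun x hx hx' => by
      have : x ∈ N ∩ (-N) := ⟨hx, hx'⟩
      simp [hNdisj] at this
    have h0 : (0 : Fin d → ℤ) ∉ N := fun h => hdisj 0 h (by simpa using h)
    constructor
    · rintro (l | ⟨l, γ, hγ⟩ | ⟨l, γ, hγ⟩) (l' | ⟨l', γ', hγ'⟩ | ⟨l', γ', hγ'⟩) h <;>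
        simp only [Sum.elim_inl, Sum.elim_inr, Prod.mk.injEq] at h <;> obtain ⟨h1, rfl⟩ := h
      · rfl
      · exact absurd (h1 ▸ hγ') h0
      · exact absurd (neg_eq_zero.1 h1.symm ▸ hγ') h0
      · exact absurd (h1 ▸ hγ) h0
      · subst h1; rfl
      · subst h1; exact absurd hγ (hdisj _ hγ')
      · exact absurd (neg_eq_zero.1 h1 ▸ hγ) h0
      · subst h1; exact absurd hγ' (hdisj _ hγ)
      · obtain rfl := neg_injective h1; rfl
    · rintro ⟨γ, l⟩
      have : γ ∈ N ∪ (-N) ∪ {0} := hNcover ▸ Set.mem_univ γ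
      rcases this with (h | h) | h
      · exact ⟨Sum.inr (Sum.inl (l, ⟨γ, h⟩)), rfl⟩
      · exact ⟨Sum.inr (Sum.inr (l, ⟨-γ, h⟩)), by simp⟩
      · obtain rfl := Set.mem_singleton_iff.1 h
        exact ⟨Sum.inl l, rfl⟩)

theorem wilsonEquiv_inl (hNdisj : N ∩ (-N) = ∅) (hNcover : N ∪ (-N) ∪ {0} = Set.univ)
    (l : Fin d → ℤ) : wilsonEquiv hNdisj hNcover (Sum.inl l) = (0, l) := rfl

theorem wilsonEquiv_inr_inl (hNdisj : N ∩ (-N) = ∅) (hNcover : N ∪ (-N) ∪ {0} = Set.univ)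
    (q : (Fin d → ℤ) × N) :
    wilsonEquiv hNdisj hNcover (Sum.inr (Sum.inl q)) = ((q.2 : Fin d → ℤ), q.1) := rfl

theorem wilsonEquiv_inr_inr (hNdisj : N ∩ (-N) = ∅) (hNcover : N ∪ (-N) ∪ {0} = Set.univ)
    (q : (Fin d → ℤ) × N) :
    wilsonEquiv hNdisj hNcover (Sum.inr (Sum.inr q)) = (-(q.2 : Fin d → ℤ), q.1) := rfl

/-- The density which, summed over all frequencies and shifts and over both signs `τ = 1`,
`τ = -1` attached to the cosets `0` and `1/2`, gives the quadratic form of the Wilson system. -/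
noncomputable def wilsonDensity (g f : L2 d) (ε : Bool) (τ : ℝ)
    (p : (Fin d → ℤ) × (Fin d → ℤ)) : ℝ :=
  (‖inner ℂ (gaborElt g ε p) f‖ ^ 2 + τ * (sign p.1 * (inner ℂ (gaborElt g ε p) f *
    inner ℂ f (gaborElt g ε (negFst p)))).re) / 2

theorem wilsonDensity_zero (g f : L2 d) (ε : Bool) (τ : ℝ) (l : Fin d → ℤ) :
    wilsonDensity g f ε τ (0, l) = (1 + τ) / 2 * ‖inner ℂ (gaborElt g ε (0, l)) f‖ ^ 2 := by
  rw [wilsonDensity, negFst_apply, neg_zero, sign_zero, one_mul, ← inner_conj_symm f,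
    Complex.mul_conj', ← Complex.ofReal_pow, Complex.ofReal_re]
  ring

theorem wilsonDensity_add_neg (g f : L2 d) (ε : Bool) {τ : ℝ} (hτ : τ = 1 ∨ τ = -1)
    (γ l : Fin d → ℤ) :
    wilsonDensity g f ε τ (γ, l) + wilsonDensity g f ε τ (-γ, l) =
      ‖inner ℂ (((1 / Real.sqrt 2 : ℝ) : ℂ) •
        (gaborElt g ε (γ, l) + ((τ : ℂ) * sign γ) • gaborElt g ε (-γ, l))) f‖ ^ 2 := by
  have hs : starRingEnd ℂ ((τ : ℂ) * sign γ) = τ * sign γ := by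
    rw [map_mul, conj_sign, Complex.conj_ofReal]
  rw [inner_smul_left, inner_add_left, inner_smul_left, hs, Complex.conj_ofReal, norm_mul, mul_pow,
    Complex.norm_real, Real.norm_of_nonneg (by positivity), div_pow, Real.sq_sqrt zero_le_two,
    wilsonDensity, wilsonDensity, negFst_apply, negFst_apply, neg_neg, sign_neg,
    ← inner_conj_symm f, ← inner_conj_symm f]
  set x : ℂ := inner ℂ (gaborElt g ε (γ, l)) f
  set y : ℂ := inner ℂ (gaborElt g ε (-γ, l)) f
  simp only [Complex.sq_norm]
  rcases hτ with rfl | rfl <;> rcases sign_eq_one_or γ with h | h <;> rw [h] <;>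
    simp [Complex.normSq_apply] <;> ring

theorem hasSum_wilson {g f : L2 d} (hNdisj : N ∩ (-N) = ∅) (hNcover : N ∪ (-N) ∪ {0} = Set.univ)
    {A B : ℝ} (hA : HasSum (wilsonDensity g f false 1) A)
    (hB : HasSum (wilsonDensity g f true (-1)) B) :
    HasSum (fun i => ‖inner ℂ (wilson N g i) f‖ ^ 2) (A + B) := by
  have hsplit : ∀ {u : (Fin d → ℤ) × (Fin d → ℤ) → ℝ} {A : ℝ}, HasSum u A →
      ∃ a b, HasSum (fun l => u (0, l)) a ∧
        HasSum (fun q : (Fin d → ℤ) × N => u ((q.2 : Fin d → ℤ), q.1) +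
          u (-(q.2 : Fin d → ℤ), q.1)) b ∧ a + b = A := by
    intro u A hu
    have h := (wilsonEquiv hNdisj hNcover).hasSum_iff.2 hu
    have h1 := (h.summable.comp_injective Sum.inl_injective).hasSum
    have h23 := h.summable.comp_injective Sum.inr_injective
    have h2 := (h23.comp_injective Sum.inl_injective).hasSum
    have h3 := (h23.comp_injective Sum.inr_injective).hasSum
    have h4 := (h1.sum (h2.sum h3)).unique h
    have h5 := h2.add h3
    simp only [Function.comp_apply, wilsonEquiv_inl, wilsonEquiv_inr_inl,
      wilsonEquiv_inr_inr] at h1 h4 h5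
    exact ⟨_, _, h1, h5, h4⟩
  obtain ⟨a, b, ha, hb, rfl⟩ := hsplit hA
  obtain ⟨a', b', ha', hb', rfl⟩ := hsplit hB
  simp only [wilsonDensity_zero] at ha ha'
  -- On the coset `1/2` the terms of frequency zero cancel.
  have ha0 : a' = 0 := by
    refine ha'.unique (hasSum_zero.congr_fun fun l => ?_)
    ring
  have key : HasSum (fun i => ‖inner ℂ (wilson N g i) f‖ ^ 2) (a + (b + b')) := by
    refine HasSum.sum (ha.congr_fun fun l => ?_)
      (HasSum.sum (hb.congr_fun ?_) (hb'.congr_fun ?_))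
    · rw [Function.comp_apply, wilson_inl]
      ring
    · rintro ⟨l, γ⟩
      simp only [Function.comp_apply]
      rw [wilson_inr_inl, wilsonDensity_add_neg _ _ _ (Or.inl rfl)]
      simp
    · rintro ⟨l, γ⟩
      simp only [Function.comp_apply]
      rw [wilson_inr_inr, wilsonDensity_add_neg _ _ _ (Or.inr rfl)]
      simp [sub_eq_add_neg]
  rw [ha0, zero_add, add_assoc]
  exact key

/-- On the span of the wave packets the quadratic form of the Gabor system is twice that of the
Wilson system, because the cross terms cancel. -/
theorem tsum_gabor_eq_two_mul_tsum_wilson (hd : 0 < d) {g : L2 d} (hNdisj : N ∩ (-N) = ∅)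
    (hNcover : N ∪ (-N) ∪ {0} = Set.univ)
    (hg : ∀ᵐ ω, (𝓕 g : L2 d) ω = starRingEnd ℂ ((𝓕 g : L2 d) ω)) {f : L2 d}
    (hf : f ∈ Submodule.span ℂ (Set.range fun p : (Fin d → ℤ) × (Fin d → ℤ) => atom p.1 p.2)) :
    Summable (fun i => ‖inner ℂ (gabor g i) f‖ ^ 2) ∧
      Summable (fun j => ‖inner ℂ (wilson N g j) f‖ ^ 2) ∧
      ∑' i, ‖inner ℂ (gabor g i) f‖ ^ 2 = 2 * ∑' j, ‖inner ℂ (wilson N g j) f‖ ^ 2 := by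
  have h0 := (summable_norm_inner_gaborElt g false hf).hasSum
  have h1 := (summable_norm_inner_gaborElt g true hf).hasSum
  set A := ∑' p, ‖inner ℂ (gaborElt g false p) f‖ ^ 2
  set B := ∑' p, ‖inner ℂ (gaborElt g true p) f‖ ^ 2
  have hG : HasSum (fun i => ‖inner ℂ (gabor g i) f‖ ^ 2) (A + B) := by
    refine (gaborEquiv hd).hasSum_iff.1 (HasSum.sum (h0.congr_fun fun p => ?_)
      (h1.congr_fun fun p => ?_))
    · simp only [Function.comp_apply, gabor_gaborEquiv_inl]
    · simp only [Function.comp_apply, gabor_gaborEquiv_inr]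
  have hc : ∀ ε, Summable fun p => (sign p.1 * (inner ℂ (gaborElt g ε p) f *
      inner ℂ f (gaborElt g ε (negFst p)))).re := fun ε => by
    have h2 : Summable fun p => inner ℂ (gaborElt g ε p) f *
        inner ℂ f (gaborElt g ε (negFst p)) := by
      refine summable_mul_of_summable_norm_sq (summable_norm_inner_gaborElt g ε hf) ?_
      simp only [norm_inner_symm f]
      exact negFst.summable_iff.2 (summable_norm_inner_gaborElt g ε hf)
    refine Summable.of_norm_bounded h2.norm fun p => ?_
    refine (Complex.abs_re_le_norm _).trans ?_
    rw [norm_mul]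
    rcases sign_eq_one_or p.1 with h | h <;> simp [h]
  have hC := (hc false).hasSum
  have hD := (hc true).hasSum
  have hcd := Complex.hasSum_re (hasSum_crossTerm hg hf hf)
  have hcd2 := (hC.sub hD).unique (hcd.congr_fun fun p => by
    rw [crossTerm, mul_sub, Complex.sub_re])
  rw [Complex.zero_re, sub_eq_zero] at hcd2
  have hW := hasSum_wilson (N := N) (g := g) (f := f) hNdisj hNcover
    ((h0.add (hC.mul_left 1)).div_const 2) ((h1.add (hD.mul_left (-1))).div_const 2)
  refine ⟨hG.summable, hW.summable, ?_⟩
  rw [hG.tsum_eq, hW.tsum_eq, hcd2]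
  ring

end Comparison

/-! ### Duality -/

section Duality

variable {d : ℕ} {N : Set (Fin d → ℤ)}

theorem halfVec_add_halfVec : halfVec d + halfVec d = intVec 1 := by
  ext i; simp [halfVec, intVec]; norm_num

theorem add_mem_shiftSet {x y : EuclideanSpace ℝ (Fin d)} (hx : x ∈ shiftSet d)
    (hy : y ∈ shiftSet d) : x + y ∈ shiftSet d := by
  rcases hx with ⟨m, rfl⟩ | ⟨m, rfl⟩ <;> rcases hy with ⟨n, rfl⟩ | ⟨n, rfl⟩
  · exact Or.inl ⟨m + n, intVec_add m n⟩
  · exact Or.inr ⟨m + n, by simp only [intVec_add]; abel⟩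
  · exact Or.inr ⟨m + n, by simp only [intVec_add]; abel⟩
  · exact Or.inl ⟨1 + (m + n), by simp only [intVec_add, ← halfVec_add_halfVec]; abel⟩

theorem neg_mem_shiftSet {x : EuclideanSpace ℝ (Fin d)} (hx : x ∈ shiftSet d) :
    -x ∈ shiftSet d := by
  rcases hx with ⟨m, rfl⟩ | ⟨m, rfl⟩
  · exact Or.inl ⟨-m, intVec_neg m⟩
  · refine Or.inr ⟨-1 - m, ?_⟩
    simp only [sub_eq_add_neg, intVec_add, intVec_neg, ← halfVec_add_halfVec]
    abel

theorem add_mem_shiftSet_iff {x y : EuclideanSpace ℝ (Fin d)} (hy : y ∈ shiftSet d) :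
    x ∈ shiftSet d ↔ x + y ∈ shiftSet d :=
  ⟨fun h => add_mem_shiftSet h hy, fun h => by
    simpa using add_mem_shiftSet h (neg_mem_shiftSet hy)⟩

/-- The frame operator of the Gabor system commutes with the time-frequency shifts: these permute
the system up to phases. -/
theorem frameOperator_gaborElt {g h : L2 d} {S : L2 d →L[ℂ] L2 d}
    (hS : ∀ f, HasSum (fun i => inner ℂ (gabor g i) f • gabor g i) (S f)) {c : ℂ}
    (hh : S h = c • g) (ε : Bool) (p : (Fin d → ℤ) × (Fin d → ℤ)) :
    S (gaborElt h ε p) = c • gaborElt g ε p := by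
  have hT : ∀ {a : EuclideanSpace ℝ (Fin d)}, a ∈ shiftSet d → ∀ f,
      S (translate a f) = translate a (S f) := by
    intro a ha f
    refine frameOperator_comm hS (translateₗᵢ a)
      (((Equiv.addRight a).subtypeEquiv fun x => add_mem_shiftSet_iff ha).prodCongr
        (Equiv.refl _)) (fun _ => 1) (fun _ => norm_one) (fun i => ?_) f
    simp only [gabor, translateₗᵢ_apply, translate_translate, one_smul]
    rfl
  have hM : ∀ (n : Fin d → ℤ) f, S (modulate (intVec n) f) = modulate (intVec n) (S f) := by
    intro n f
    refine frameOperator_comm hS (modulateₗᵢ (intVec n))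
      ((Equiv.refl _).prodCongr (Equiv.addRight n))
      (fun i => planeWave (intVec n) i.1) (fun _ => norm_planeWave _ _) (fun i => ?_) f
    simp [gabor, modulate_translate, modulate_modulate, intVec_add]
  have hmem : cosetVec d ε + intVec p.2 ∈ shiftSet d := by
    cases ε
    · exact Or.inl ⟨p.2, by simp [cosetVec]⟩
    · exact Or.inr ⟨p.2, by simp [cosetVec]⟩
  rw [gaborElt, hT hmem, hM, hh, gaborElt, ← translate_smul]
  congr 1
  exact (modulateₗᵢ _).map_smul c g

theorem frameOperator_wilson {g h : L2 d} {S : L2 d →L[ℂ] L2 d}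
    (hh : ∀ ε p, S (gaborElt h ε p) = gaborElt g ε p) (i : WilsonIndex N) :
    S (wilson N h i) = wilson N g i := by
  rcases i with l | ⟨l, γ⟩ | ⟨l, γ⟩
  · rw [wilson_inl, wilson_inl, hh]
  · rw [wilson_inr_inl, wilson_inr_inl, map_smul, map_add, map_smul, hh, hh]
  · rw [wilson_inr_inr, wilson_inr_inr, map_smul, map_sub, map_smul, hh, hh]

theorem inner_frameOperator_comm {ι H : Type*} [NormedAddCommGroup H] [InnerProductSpace ℂ H]
    {φ : ι → H} {S : H → H} (hS : ∀ f, HasSum (fun i => inner ℂ (φ i) f • φ i) (S f)) (x y : H) :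
    inner ℂ (S x) y = inner ℂ x (S y) := by
  have h1 := hasSum_inner_mul_inner (hS y) x
  have h2 := (hasSum_inner_mul_inner (hS x) y).map (starRingEnd ℂ) Complex.continuous_conj
  rw [inner_conj_symm] at h2
  refine h2.unique (h1.congr_fun fun i => ?_)
  simp only [Function.comp_apply, map_mul, inner_conj_symm]
  ring

theorem inner_atom_atom (m : Fin d → ℤ) :
    inner ℂ (atom m 0) (atom 0 0) = if m = 0 then (1 : ℂ) else 0 := by
  have h : ∀ᵐ x, (𝓕 (atom 0 0) : L2 d) x = (intCube (0 : Fin d → ℤ)).indicator (fun _ => 1) x := by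
    rw [atom, fourier_fourierInv_eq]
    filter_upwards [(memLp_indicator_planeWave (0 : Fin d → ℤ) 0).coeFn_toLp] with x hx
    rw [hx, intVec_zero]
    congr 1
    funext x
    simp
  have h2 : inner ℂ (atom m 0) (atom 0 0) =
      ∫ _ in unitCube d, if m = 0 then (1 : ℂ) else 0 := by
    rw [inner_atom, cubeCoeff]
    refine integral_congr_ae ?_
    filter_upwards [ae_restrict_of_ae (ae_add_right h (intVec m)),
      ae_restrict_mem measurableSet_unitCube] with x hx hx'
    have hm : x + intVec m ∈ intCube m := by simpa [intCube] using hx'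
    have hm2 : x + intVec m ∈ intCube (0 : Fin d → ℤ) ↔ m = 0 := by
      rw [mem_intCube_iff, ← mem_intCube_iff.1 hm, eq_comm]
    rw [hx, intVec_zero, neg_zero, planeWave_zero_left, one_mul]
    by_cases hm3 : m = 0
    · rw [Set.indicator_of_mem (hm2.2 hm3), if_pos hm3]
    · rw [Set.indicator_of_notMem (mt hm2.1 hm3), if_neg hm3]
  rw [h2, setIntegral_const, Measure.real, volume_unitCube]
  simp

/-- The Wexler–Raz biorthogonality relation for integer frequencies of even parity. It results from
testing the reconstruction formula `2 f = ∑ ⟪φ i, f⟫ γ i`, where `φ` and `γ` are the Gabor systems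
of `h` and `g`, against two wave packets: each coset of shifts contributes `⟪h, M_m g⟫`. -/
theorem inner_modulate_dual (hd : 0 < d) {g h : L2 d} {S : L2 d →L[ℂ] L2 d}
    (hS : ∀ f, HasSum (fun i => inner ℂ (gabor g i) f • gabor g i) (S f))
    (hsurj : Function.Surjective S) (hh : S h = (2 : ℂ) • g) {m : Fin d → ℤ} (hm : sign m = 1) :
    inner ℂ h (modulate (intVec m) g) = if m = 0 then (1 : ℂ) else 0 := by
  obtain ⟨n, rfl⟩ : ∃ n, m = -n := ⟨-m, (neg_neg m).symm⟩
  rw [sign_neg] at hm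
  obtain ⟨x, hx⟩ := hsurj (atom 0 0)
  have hcoef : ∀ ε p, (2 : ℂ) * inner ℂ (gaborElt g ε p) x =
      inner ℂ (gaborElt h ε p) (atom 0 0) := fun ε p => by
    rw [← hx, ← inner_frameOperator_comm hS, frameOperator_gaborElt hS hh, inner_smul_left,
      map_ofNat]
  have htot := (hasSum_inner_mul_inner (hS x) (atom n 0)).mul_left 2
  rw [hx, inner_atom_atom] at htot
  set I : ℂ := inner ℂ h (modulate (intVec (-n)) g) with hI
  have hsum : ∀ ε, HasSum (fun p => inner ℂ (gaborElt h ε p) (atom 0 0) *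
      inner ℂ (atom n 0) (gaborElt g ε p)) I := fun ε => by
    have hs : Summable fun p => inner ℂ (gaborElt h ε p) (atom 0 0) *
        inner ℂ (atom n 0) (gaborElt g ε p) := by
      refine summable_mul_of_summable_norm_sq (summable_norm_inner_gaborElt_atom h ε 0 0) ?_
      simp only [norm_inner_symm (atom n 0)]
      exact summable_norm_inner_gaborElt_atom g ε n 0
    have h1 : HasSum (fun γ : Fin d → ℤ => cubeInner (𝓕 h : L2 d) (𝓕 g) 0 (0 - γ) (n - γ)) I := by
      have h2 := (Equiv.neg (Fin d → ℤ)).hasSum_iff.2 (hasSum_cubeInner (𝓕 h : L2 d) (𝓕 g) n)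
      rw [integral_conj_mul_comp_add, ← intVec_neg, ← fourier_modulate, Lp.inner_fourier_eq] at h2
      refine h2.congr_fun fun γ => ?_
      simp [sub_eq_add_neg]
    have h3 := hs.hasSum.prod_fiberwise fun γ =>
      hasSum_inner_gaborElt_mul h g ε 0 0 n 0 γ γ
    have h4 : ∀ k : Fin d → ℤ, sign k = 1 → cosetSign ε k = 1 := fun k hk => by
      cases ε <;> simp [cosetSign, hk]
    simp only [h4 n hm, h4 0 sign_zero, one_mul, sub_self, intVec_zero] at h3
    rw [← h3.unique h1]
    exact hs.hasSum
  have htot2 := (HasSum.sum (f := (fun i => 2 * (inner ℂ (gabor g i) x *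
    inner ℂ (atom n 0) (gabor g i))) ∘ gaborEquiv hd) ((hsum false).congr_fun fun p => by
      simp only [Function.comp_apply, gabor_gaborEquiv_inl, ← hcoef, mul_assoc])
    ((hsum true).congr_fun fun p => by
      simp only [Function.comp_apply, gabor_gaborEquiv_inr, ← hcoef, mul_assoc]))
  rw [(gaborEquiv hd).hasSum_iff] at htot2
  have h5 := htot2.unique htot
  rw [← two_mul] at h5
  rw [mul_left_cancel₀ two_ne_zero h5]
  simp only [neg_eq_zero]

theorem inner_modulate_modulate (a b : EuclideanSpace ℝ (Fin d)) (f g : L2 d) :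
    inner ℂ (modulate a f) (modulate b g) = inner ℂ f (modulate (b - a) g) := by
  have h := (modulateₗᵢ a).inner_map_map f (modulate (b - a) g)
  rw [modulateₗᵢ_apply, modulateₗᵢ_apply, modulate_modulate, sub_add_cancel] at h
  exact h

theorem inner_gaborElt_gaborElt (g h : L2 d) (ε : Bool) (γ γ' l : Fin d → ℤ) :
    inner ℂ (gaborElt h ε (γ, l)) (gaborElt g ε (γ', l)) =
      inner ℂ h (modulate (intVec (γ' - γ)) g) := by
  rw [intVec_sub, ← inner_modulate_modulate]
  exact (translateₗᵢ _).inner_map_map _ _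

theorem inner_wilson_dual {g h : L2 d} (h0 : (0 : Fin d → ℤ) ∉ N)
    (hdual : ∀ m : Fin d → ℤ, sign m = 1 →
      inner ℂ h (modulate (intVec m) g) = if m = 0 then (1 : ℂ) else 0) (i : WilsonIndex N) :
    inner ℂ (wilson N h i) (wilson N g i) = 1 := by
  have hd1 := hdual 0 sign_zero
  rw [if_pos rfl] at hd1
  have hne : ∀ γ : N, (γ : Fin d → ℤ) + γ ≠ 0 := fun γ h => by
    refine h0 ?_
    have : (γ : Fin d → ℤ) = 0 := by
      funext i
      have := congr_fun h i
      simp only [Pi.add_apply, Pi.zero_apply] at this ⊢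
      omega
    exact this ▸ γ.2
  have hd2 : ∀ γ : N, inner ℂ h (modulate (intVec ((γ : Fin d → ℤ) + γ)) g) = (0 : ℂ) := fun γ => by
    rw [hdual _ (by rw [sign_add, sign_mul_self]), if_neg (hne γ)]
  have hd3 : ∀ γ : N, inner ℂ h (modulate (intVec (-(γ : Fin d → ℤ) - γ)) g) = (0 : ℂ) :=
    fun γ => by
    rw [hdual _ (by rw [sub_eq_add_neg, sign_add, sign_mul_self]), if_neg]
    intro h
    apply hne γ
    rw [← neg_eq_zero, neg_add, ← h, sub_eq_add_neg]
  have hsq : ((1 / Real.sqrt 2 : ℝ) : ℂ) * ((1 / Real.sqrt 2 : ℝ) : ℂ) * 2 = 1 := by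
    rw [← Complex.ofReal_mul, div_mul_div_comm, Real.mul_self_sqrt zero_le_two]
    norm_num
  rcases i with l | ⟨l, γ⟩ | ⟨l, γ⟩
  · rw [wilson_inl, wilson_inl, inner_gaborElt_gaborElt, sub_self, hd1]
  · rw [wilson_inr_inl, wilson_inr_inl]
    simp only [inner_smul_left, inner_smul_right, inner_add_left, inner_add_right,
      inner_gaborElt_gaborElt, sub_self, sub_neg_eq_add, hd1, hd2, hd3, conj_sign,
      Complex.conj_ofReal]
    linear_combination hsq + ((1 / Real.sqrt 2 : ℝ) : ℂ) * ((1 / Real.sqrt 2 : ℝ) : ℂ) *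
      sign_mul_self (γ : Fin d → ℤ)
  · rw [wilson_inr_inr, wilson_inr_inr]
    simp only [inner_smul_left, inner_smul_right, inner_sub_left, inner_sub_right,
      inner_gaborElt_gaborElt, sub_self, sub_neg_eq_add, hd1, hd2, hd3, conj_sign,
      Complex.conj_ofReal]
    linear_combination hsq + ((1 / Real.sqrt 2 : ℝ) : ℂ) * ((1 / Real.sqrt 2 : ℝ) : ℂ) *
      sign_mul_self (γ : Fin d → ℤ)

end Duality

/-! ### Frames and Riesz bases -/

section Main

variable {d : ℕ} {N : Set (Fin d → ℤ)}

/-- Bessel systems of the two kinds have proportional frame operators. -/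
theorem exists_frameOperators (hd : 0 < d) {g : L2 d} (hNdisj : N ∩ (-N) = ∅)
    (hNcover : N ∪ (-N) ∪ {0} = Set.univ)
    (hg : ∀ᵐ ω, (𝓕 g : L2 d) ω = starRingEnd ℂ ((𝓕 g : L2 d) ω)) {b b' : ℝ}
    (hG : IsBesselWith (gabor g) b) (hW : IsBesselWith (wilson N g) b') :
    ∃ S S' : L2 d →L[ℂ] L2 d,
      (∀ f, HasSum (fun i => inner ℂ (gabor g i) f • gabor g i) (S f)) ∧
      (∀ f, HasSum (fun i => inner ℂ (wilson N g i) f • wilson N g i) (S' f)) ∧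
      ∀ f, S f = (2 : ℂ) • S' f := by
  obtain ⟨S, hS⟩ := (hG.mono (le_max_left b 0)).exists_frameOperator (le_max_right b 0)
  obtain ⟨S', hS'⟩ := (hW.mono (le_max_left b' 0)).exists_frameOperator (le_max_right b' 0)
  exact ⟨S, S', hS, hS', frameOperator_eq_two_smul dense_span_atom
    (fun f hf => (tsum_gabor_eq_two_mul_tsum_wilson hd hNdisj hNcover hg hf).2.2) hS hS'⟩

theorem isBesselWith_gabor_iff (hd : 0 < d) {g : L2 d} (hNdisj : N ∩ (-N) = ∅)
    (hNcover : N ∪ (-N) ∪ {0} = Set.univ)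
    (hg : ∀ᵐ ω, (𝓕 g : L2 d) ω = starRingEnd ℂ ((𝓕 g : L2 d) ω)) (b : ℝ) :
    IsBesselWith (gabor g) b ↔ IsBesselWith (wilson N g) (b / 2) :=
  isBesselWith_iff_of_dense dense_span_atom
    (fun _ hf => tsum_gabor_eq_two_mul_tsum_wilson hd hNdisj hNcover hg hf) b

theorem isFrameWith_gabor_iff (hd : 0 < d) {g : L2 d} (hNdisj : N ∩ (-N) = ∅)
    (hNcover : N ∪ (-N) ∪ {0} = Set.univ)
    (hg : ∀ᵐ ω, (𝓕 g : L2 d) ω = starRingEnd ℂ ((𝓕 g : L2 d) ω)) (a b : ℝ) :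
    IsFrameWith (gabor g) (2 * a) (2 * b) ↔ IsFrameWith (wilson N g) a b := by
  have hB := isBesselWith_gabor_iff hd hNdisj hNcover hg (2 * b)
  rw [mul_div_cancel_left₀ b two_ne_zero] at hB
  unfold IsFrameWith
  rw [hB, mul_pos_iff_of_pos_left two_pos]
  refine and_congr_right fun _ => and_congr_right fun hW => forall_congr' fun f => ?_
  obtain ⟨S, S', hS, hS', h⟩ := exists_frameOperators hd hNdisj hNcover hg (hB.2 hW) hW
  have h2 : ∑' i, ‖inner ℂ (gabor g i) f‖ ^ 2 = 2 * ∑' i, ‖inner ℂ (wilson N g i) f‖ ^ 2 := by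
    rw [(hasSum_norm_inner_sq (hS f)).1.tsum_eq, (hasSum_norm_inner_sq (hS' f)).1.tsum_eq, h,
      inner_smul_right]
    simp
  rw [h2, mul_assoc, mul_le_mul_iff_right₀ two_pos]

/-- A Wilson frame is a Riesz basis: the Wexler–Raz relation for the dual window shows that
the dual frame has diagonal inner products equal to one. -/
theorem isRieszBasisWith_wilson_of_isFrameWith (hd : 0 < d) {g : L2 d} (hNdisj : N ∩ (-N) = ∅)
    (hNcover : N ∪ (-N) ∪ {0} = Set.univ)
    (hg : ∀ᵐ ω, (𝓕 g : L2 d) ω = starRingEnd ℂ ((𝓕 g : L2 d) ω)) {a b : ℝ}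
    (hW : IsFrameWith (wilson N g) a b) : IsRieszBasisWith (wilson N g) a b := by
  have hG := (isFrameWith_gabor_iff hd hNdisj hNcover hg a b).2 hW
  obtain ⟨S, S', hS, hS', h⟩ := exists_frameOperators hd hNdisj hNcover hg hG.2.1 hW.2.1
  have hsurj' : Function.Surjective S' := by
    have hu : IsUnit S' := by
      refine S'.isUnit_of_forall_le_norm_inner_map (c := ⟨a, hW.1.le⟩) hW.1 fun x => ?_
      have h1 := hW.2.2 x
      rw [(hasSum_norm_inner_sq (hS' x)).1.tsum_eq] at h1
      rw [norm_inner_symm, mul_comm]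
      exact h1.trans (Complex.re_le_norm _)
    exact (ContinuousLinearMap.isUnit_iff_bijective.1 hu).2
  have hsurj : Function.Surjective S := fun y => by
    obtain ⟨x, hx⟩ := hsurj' ((2 : ℂ)⁻¹ • y)
    exact ⟨x, by rw [h, hx, smul_inv_smul₀ two_ne_zero]⟩
  obtain ⟨u, hu⟩ := hsurj' g
  have hu2 : S u = (2 : ℂ) • g := by rw [h, hu]
  have hcomm : ∀ ε p, S' (gaborElt u ε p) = gaborElt g ε p := fun ε p => by
    have h1 := frameOperator_gaborElt hS hu2 ε p
    rw [h] at h1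
    exact smul_right_injective _ (two_ne_zero' ℂ) h1
  have h0 : (0 : Fin d → ℤ) ∉ N := fun h0 => by
    have : (0 : Fin d → ℤ) ∈ N ∩ (-N) := ⟨h0, by simpa using h0⟩
    simp [hNdisj] at this
  exact hW.isRieszBasisWith hS' (frameOperator_wilson hcomm)
    (inner_wilson_dual h0 fun m hm => inner_modulate_dual hd hS hsurj hu2 hm)

end Main

end WilsonSystem

theorem mainTheorem1 {d : ℕ} (hd : 0 < d) (g : WilsonSystem.L2 d) (N : Set (Fin d → ℤ))
    (hNdisj : N ∩ (-N) = ∅) (hNcover : N ∪ (-N) ∪ {0} = Set.univ)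
    (hg : ∀ᵐ ω : EuclideanSpace ℝ (Fin d),
      (𝓕 g : WilsonSystem.L2 d) ω = starRingEnd ℂ ((𝓕 g : WilsonSystem.L2 d) ω)) :
    ((∀ b : ℝ, WilsonSystem.IsBesselWith (WilsonSystem.gabor g) b ↔
          WilsonSystem.IsBesselWith (WilsonSystem.wilson N g) (b / 2)) ∧
      ((∃ b : ℝ, WilsonSystem.IsBesselWith (WilsonSystem.gabor g) b ∨
          WilsonSystem.IsBesselWith (WilsonSystem.wilson N g) b) →
        ∀ f : WilsonSystem.L2 d,
          Summable (fun i => inner ℂ (WilsonSystem.gabor g i) f • WilsonSystem.gabor g i) ∧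
          Summable (fun i => inner ℂ (WilsonSystem.wilson N g i) f • WilsonSystem.wilson N g i) ∧
          WilsonSystem.frameOperator (WilsonSystem.gabor g) f =
            (2 : ℂ) • WilsonSystem.frameOperator (WilsonSystem.wilson N g) f)) ∧
    (∀ a b : ℝ, WilsonSystem.IsFrameWith (WilsonSystem.gabor g) (2 * a) (2 * b) ↔
      WilsonSystem.IsRieszBasisWith (WilsonSystem.wilson N g) a b) ∧
    (WilsonSystem.IsTightFrameWith (WilsonSystem.gabor g) 2 ↔
      WilsonSystem.IsOrthonormalBasis (WilsonSystem.wilson N g)) := by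
  have hB := WilsonSystem.isBesselWith_gabor_iff hd hNdisj hNcover hg
  have hR : ∀ a b : ℝ, WilsonSystem.IsFrameWith (WilsonSystem.gabor g) (2 * a) (2 * b) ↔
      WilsonSystem.IsRieszBasisWith (WilsonSystem.wilson N g) a b := fun a b => by
    rw [WilsonSystem.isFrameWith_gabor_iff hd hNdisj hNcover hg]
    exact ⟨WilsonSystem.isRieszBasisWith_wilson_of_isFrameWith hd hNdisj hNcover hg,
      fun h => h.isFrameWith⟩
  refine ⟨⟨hB, ?_⟩, hR, ?_⟩
  · rintro ⟨b, hb⟩ f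
    obtain ⟨b, hG⟩ : ∃ b, WilsonSystem.IsBesselWith (WilsonSystem.gabor g) b := by
      rcases hb with hb | hb
      · exact ⟨b, hb⟩
      · exact ⟨2 * b, (hB _).2 (by rwa [mul_div_cancel_left₀ b two_ne_zero])⟩
    obtain ⟨S, S', hS, hS', h⟩ :=
      WilsonSystem.exists_frameOperators hd hNdisj hNcover hg hG ((hB b).1 hG)
    refine ⟨(hS f).summable, (hS' f).summable, ?_⟩
    rw [WilsonSystem.frameOperator, WilsonSystem.frameOperator, (hS f).tsum_eq, (hS' f).tsum_eq, h]
  · rw [← WilsonSystem.isRieszBasisWith_one_one_iff, ← hR, mul_one]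
    rfl
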